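/- Fix a countable set of atoms. Formulas of $L(U,S)$ are built from atoms by $\neg$, $\wedge$ and the binary connectives $U$ (until) and $S$ (since); the length of a formula is its number of occurrences of atoms and connectives. In a structure $\mathcal T=(T,<,h)$ ($(T,<)$ an irreflexive linear order, $h(p)\subseteq T$ for each atom $p$) truth is defined as usual, with $\mathcal T,x\models U(\alpha,\beta)$ iff there is $y>x$ with $\mathcal T,y\models\alpha$ and $\mathcal T,z\models\beta$ for all $x<z<y$, and $S$ the mirror image. Let $\mathrm{Cl}\,\psi$ be the set of all subformulas of $\psi$ and their negations; ${\sim}\alpha$ is $\beta$ if $\alpha=\neg\beta$ and $\neg\alpha$ otherwise. A set $X\subseteq\mathrm{Cl}\,\psi$ is propositionally consistent if no $\neg(\alpha_1\wedge\dots\wedge\alpha_n)$ with all $\alpha_i\in X$ is a substitution instance of a propositional tautology; it is MPC if it is maximal among such subsets of $\mathrm{Cl}\,\psi$. **Mosaics.** A $\psi$-mosaic is a triple $(A,B,C)$ (start, cover, end) of subsets of $\mathrm{Cl}\,\psi$ with $A,C$ MPC; with $\neg\beta\in B\iff{\sim}\beta\in B$ whenever $\beta,\neg\beta\in\mathrm{Cl}\,\psi$;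 and such that (C1) if $\neg U(\alpha,\beta)\in A$ and $\beta\in B$, then $\neg\alpha\in C$, and $\neg\beta\in C$ or $\neg U(\alpha,\beta)\in C$, and $\neg\alpha,\neg U(\alpha,\beta)\in B$; (C2) if $U(\alpha,\beta)\in A$ and $\neg\alpha\in B$, then $\alpha\in C$ or $\beta,U(\alpha,\beta)\in C$, and $\beta,U(\alpha,\beta)\in B$; and the mirror images of (C1), (C2) hold (for $S$, with $A$ and $C$ exchanged). Mosaics $(A',B',C')$ and $(A'',B'',C'')$ compose if $C'=A''$, with composition $(A',B'\cap C'\cap B'',C'')$; this extends to non-empty finite sequences. A sequence $(A_i,B_i,C_i)_{1\le i\le n}$ of $\psi$-mosaics composing to $(A,B,C)$ is a full decomposition of it if (1) for each $U(\alpha,\beta)\in A$, either $\beta\in B$ and ($\alpha\in C$ or $\beta,U(\alpha,\beta)\in C$), or there is $1\le i<n$ with $\alpha\in C_i$, $\beta\in B_j$ for all $j\le i$ and $\beta\in C_j$ for all $j<i$; (2) the mirror image of (1) holds for each $S(\alpha,\beta)\in C$; (3) for each $\beta\in\mathrm{Cl}\,\psi$ with ${\sim}\beta\notin B$ there is $1\le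 i<n$ with $\beta\in C_i$. Then $(A,B,C)$ is said to be fully decomposed by the sequence. **Tactics.** For a non-empty sequence $\sigma$ of $\psi$-mosaics, $m$ is fully decomposed by $\mathrm{lead}(\sigma)$ if $\langle m\rangle{}^\wedge\sigma$ is a full decomposition of $m$, and by $\mathrm{trail}(\sigma)$ if $\sigma^\wedge\langle m\rangle$ is. Let $r,s\ge0$, let $P_0,\dots,P_s\subseteq\mathrm{Cl}\,\psi$ be MPC, and let $\lambda_1,\dots,\lambda_r$ be non-empty composing sequences of $\psi$-mosaics, $A_i$ the start of the first and $C_i$ the end of the last mosaic of $\lambda_i$. For a $\psi$-mosaic $o=(A,B,C)$ put $m'=(A,B,P_0)$, $m''=(P_0,B,C)$, $y_i=(P_i,B,P_{i+1})$ for $i<s$, $y_s=(P_s,B,P_0)$, $\mu=\langle y_0,\dots,y_s\rangle$. If $r=0$ let $\lambda$ be empty; if $r>0$ put $x_0=(P_0,B,A_1)$, $x_i=(C_i,B,A_{i+1})$ for $0<i<r$, $x_r=(C_r,B,P_0)$ and $\lambda=\langle x_0\rangle{}^\wedge\lambda_1{}^\wedge\langle x_1\rangle{}^\wedge\cdots{}^\wedge\lambda_r{}^\wedge\langle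 x_r\rangle$. Then $o$ is fully decomposed by $\mathrm{shuffle}(\langle P_0,\dots,P_s\rangle,\langle\lambda_1,\dots,\lambda_r\rangle)$ if $m'$, $m''$, all $y_i$ and (for $r>0$) all $x_i$ are $\psi$-mosaics and (F1) $o$ is fully decomposed by $\langle m'\rangle{}^\wedge\lambda^\wedge\mu^\wedge\langle m''\rangle$; (F2) if $r>0$, $x_0$ is fully decomposed by $\lambda^\wedge\mu^\wedge\langle x_0\rangle$; (F3) for $0<i<r$, $x_i$ is fully decomposed by $\langle x_i\rangle{}^\wedge\lambda_{i+1}{}^\wedge\langle x_{i+1}\rangle{}^\wedge\cdots{}^\wedge\lambda_r{}^\wedge\langle x_r\rangle{}^\wedge\mu^\wedge\langle x_0\rangle{}^\wedge\lambda_1{}^\wedge\langle x_1\rangle{}^\wedge\cdots{}^\wedge\lambda_i{}^\wedge\langle x_i\rangle$; (F4) if $r>0$, $x_r$ is fully decomposed by $\langle x_r\rangle{}^\wedge\mu^\wedge\lambda$; (F5) for $0\le i<s$, $y_i$ is fully decomposed by $\langle y_i,\dots,y_s\rangle{}^\wedge\lambda^\wedge\langle y_0,\dots,y_i\rangle$;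 (F6) $y_s$ is fully decomposed by $\langle y_s\rangle{}^\wedge\lambda^\wedge\mu$. **Real mosaic systems.** Let $S$ be a set of $\psi$-mosaics. There are no level $0^-$ members of $S$. For $n\ge0$, a mosaic $m\in S$ is a level $n$ member of $S$ if $m$ is the composition of a sequence of $\psi$-mosaics, each of which is a level $n^-$ member of $S$ or is fully decomposed by a shuffle all of whose sequences $\lambda_i$ consist of level $n^-$ members of $S$. A $\psi$-mosaic is a level $n^+$ (respectively level $(n+1)^-$) member of $S$ if it is the composition of a sequence of $\psi$-mosaics, each of which is a level $n$ (respectively level $n^+$) member of $S$ or is fully decomposed by some $\mathrm{lead}(\sigma)$ or $\mathrm{trail}(\sigma)$ with all mosaics of $\sigma$ being level $n$ (respectively level $n^+$) members of $S$. $S$ is a real mosaic system if each $m\in S$ is a level $n$ member of $S$ for some $n$; it has depth $n$ if each $m\in S$ is a level $n$ member of $S$. **Satisfiability.** A $\psi$-mosaic is $[0,1]$-satisfiable if for some structure $\mathcal T=([0,1],<,h)$ and some $x<y$ in $[0,1]$ it equals $(A,B,C)$, where $A$ and $C$ are the sets of formulas of $\mathrm{Cl}\,\psi$ true at $x$ and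 at $y$, and $B$ is the set of those true at all $z$ with $x<z<y$. **Lemma.** Let $\psi$ be a formula of $L(U,S)$ of length $L$ and let $m_0$ be a $[0,1]$-satisfiable $\psi$-mosaic. Then there is a real mosaic system of $\psi$-mosaics of depth $2L$ that contains $m_0$. -/

import Mathlib

namespace RTL

/-! ### The language with Until and Since -/

/-- Formulas built from atoms by negation, conjunction, Until and Since. -/
inductive Formula (Atom : Type*) where
  | atom : Atom → Formula Atom
  | neg : Formula Atom → Formula Atom
  | conj : Formula Atom → Formula Atom → Formula Atom
  | untl : Formula Atom → Formula Atom → Formula Atom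
  | snce : Formula Atom → Formula Atom → Formula Atom

namespace Formula

variable {Atom : Type*}

/-- The length of a formula: its number of symbols, that is, the number of occurrences of atoms
and connectives (brackets and commas are not counted). -/
def length : Formula Atom → ℕ
  | atom _ => 1
  | neg α => α.length + 1
  | conj α β => α.length + β.length + 1
  | untl α β => α.length + β.length + 1
  | snce α β => α.length + β.length + 1

/-- `IsSubformula χ φ`: `χ` is a (not necessarily proper) subformula of `φ`. -/
def IsSubformula (χ : Formula Atom) : Formula Atom → Prop
  | atom p => χ = atom p
  | neg α => χ = neg α ∨ IsSubformula χ α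
  | conj α β => χ = conj α β ∨ IsSubformula χ α ∨ IsSubformula χ β
  | untl α β => χ = untl α β ∨ IsSubformula χ α ∨ IsSubformula χ β
  | snce α β => χ = snce α β ∨ IsSubformula χ α ∨ IsSubformula χ β

/-- The closure of `φ`: all subformulas of `φ` and their negations. -/
def closure (φ : Formula Atom) : Set (Formula Atom) :=
  {χ | IsSubformula χ φ ∨ ∃ α, IsSubformula α φ ∧ χ = neg α}

/-- `sim α` is `β` if `α` is `¬ β`, and `¬ α` otherwise. -/
def sim : Formula Atom → Formula Atom
  | neg β => β
  | α => neg α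

/-- Truth of a formula at a point of the structure `(T, <, h)`. -/
def Sat {T : Type*} [LinearOrder T] (h : Atom → Set T) : Formula Atom → T → Prop
  | atom p, x => x ∈ h p
  | neg α, x => ¬ Sat h α x
  | conj α β, x => Sat h α x ∧ Sat h β x
  | untl α β, x => ∃ y, x < y ∧ Sat h α y ∧ ∀ z, x < z → z < y → Sat h β z
  | snce α β, x => ∃ y, y < x ∧ Sat h α y ∧ ∀ z, y < z → z < x → Sat h β z

/-- The conjunction `α₁ ∧ (α₂ ∧ (… ∧ αₙ))` of a non-empty list, given by its head and tail. -/
def conjList : Formula Atom → List (Formula Atom) → Formula Atom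
  | α, [] => α
  | α, β :: l => conj α (conjList β l)

end Formula

/-! ### Propositional consistency -/

/-- Formulas of classical propositional logic. -/
inductive PropFormula where
  | var : ℕ → PropFormula
  | neg : PropFormula → PropFormula
  | conj : PropFormula → PropFormula → PropFormula

namespace PropFormula

/-- Truth under a propositional valuation. -/
def Eval (v : ℕ → Prop) : PropFormula → Prop
  | var i => v i
  | neg a => ¬ Eval v a
  | conj a b => Eval v a ∧ Eval v b

/-- A tautology of classical propositional logic. -/
def IsTautology (a : PropFormula) : Prop := ∀ v : ℕ → Prop, a.Eval v

/-- Substitution of temporal formulas for the propositional variables. -/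
def subst {Atom : Type*} (f : ℕ → Formula Atom) : PropFormula → Formula Atom
  | var i => f i
  | neg a => Formula.neg (subst f a)
  | conj a b => Formula.conj (subst f a) (subst f b)

end PropFormula

section

variable {Atom : Type*}

/-- `χ` is a substitution instance of a propositional tautology. -/
def IsTautologyInstance (χ : Formula Atom) : Prop :=
  ∃ a : PropFormula, a.IsTautology ∧ ∃ f : ℕ → Formula Atom, a.subst f = χ

/-- Propositional consistency: no `¬ (α₁ ∧ … ∧ αₙ)` with all `αᵢ ∈ S` is a substitution instance
of a tautology. -/
def PropConsistent (S : Set (Formula Atom)) : Prop :=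
  ∀ (α : Formula Atom) (l : List (Formula Atom)), α ∈ S → (∀ β ∈ l, β ∈ S) →
    ¬ IsTautologyInstance (Formula.neg (Formula.conjList α l))

/-- Maximally propositionally consistent subsets of the closure of `φ`. -/
def IsMPC (φ : Formula Atom) (S : Set (Formula Atom)) : Prop :=
  Maximal (fun X : Set (Formula Atom) => X ⊆ φ.closure ∧ PropConsistent X) S

/-! ### Mosaics -/

/-- A triple `(start, cover, finish)` of sets of formulas; `finish` is the end of the triple. -/
@[ext] structure Triple (Atom : Type*) where
  start : Set (Formula Atom)
  cover : Set (Formula Atom)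
  finish : Set (Formula Atom)

open Formula in
/-- The triple `m` is a `φ`-mosaic. -/
structure IsMosaic (φ : Formula Atom) (m : Triple Atom) : Prop where
  cover_subset : m.cover ⊆ φ.closure
  start_mpc : IsMPC φ m.start
  finish_mpc : IsMPC φ m.finish
  neg_iff_sim : ∀ β, β ∈ φ.closure → neg β ∈ φ.closure → (neg β ∈ m.cover ↔ sim β ∈ m.cover)
  c1 : ∀ α β, neg (untl α β) ∈ m.start → β ∈ m.cover →
    (neg α ∈ m.finish ∧ (neg β ∈ m.finish ∨ neg (untl α β) ∈ m.finish)) ∧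
    (neg α ∈ m.cover ∧ neg (untl α β) ∈ m.cover)
  c2 : ∀ α β, untl α β ∈ m.start → neg α ∈ m.cover →
    (α ∈ m.finish ∨ (β ∈ m.finish ∧ untl α β ∈ m.finish)) ∧
    (β ∈ m.cover ∧ untl α β ∈ m.cover)
  c3 : ∀ α β, neg (snce α β) ∈ m.finish → β ∈ m.cover →
    (neg α ∈ m.start ∧ (neg β ∈ m.start ∨ neg (snce α β) ∈ m.start)) ∧
    (neg α ∈ m.cover ∧ neg (snce α β) ∈ m.cover)
  c4 : ∀ α β, snce α β ∈ m.finish → neg α ∈ m.cover →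
    (α ∈ m.start ∨ (β ∈ m.start ∧ snce α β ∈ m.start)) ∧
    (β ∈ m.cover ∧ snce α β ∈ m.cover)

/-- `ComposesTo l m`: the non-empty sequence `l` composes to `m`. Two triples compose if the end
of the first is the start of the second; the cover of the composition is the intersection of the
two covers and of the common middle set. -/
inductive ComposesTo : List (Triple Atom) → Triple Atom → Prop
  | single (m : Triple Atom) : ComposesTo [m] m
  | cons (m m' : Triple Atom) (l : List (Triple Atom)) :
      ComposesTo l m' → m.finish = m'.start →
      ComposesTo (m :: l) ⟨m.start, m.cover ∩ m.finish ∩ m'.cover, m'.finish⟩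

/-- `l` is a decomposition of the `φ`-mosaic `m`: a finite sequence of `φ`-mosaics which composes
to `m`. -/
def IsDecomposition (φ : Formula Atom) (l : List (Triple Atom)) (m : Triple Atom) : Prop :=
  IsMosaic φ m ∧ (∀ x ∈ l, IsMosaic φ x) ∧ ComposesTo l m

open Formula in
/-- `l` is a full decomposition of `m`. The sequence is indexed from `0` here. -/
structure IsFullDecomposition (φ : Formula Atom) (l : List (Triple Atom)) (m : Triple Atom) :
    Prop where
  decomposition : IsDecomposition φ l m
  untl_cured : ∀ α β, untl α β ∈ m.start →
    (β ∈ m.cover ∧ ((β ∈ m.finish ∧ untl α β ∈ m.finish) ∨ α ∈ m.finish)) ∨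
    ∃ (i : ℕ) (hi : i + 1 < l.length), α ∈ l[i].finish ∧
      (∀ (j : ℕ) (hj : j ≤ i), β ∈ l[j].cover) ∧
      (∀ (j : ℕ) (hj : j < i), β ∈ l[j].finish)
  snce_cured : ∀ α β, snce α β ∈ m.finish →
    (β ∈ m.cover ∧ ((β ∈ m.start ∧ snce α β ∈ m.start) ∨ α ∈ m.start)) ∨
    ∃ (i : ℕ) (_ : 0 < i) (hi : i < l.length), α ∈ l[i].start ∧
      (∀ (j : ℕ) (_ : i ≤ j) (hj : j < l.length), β ∈ l[j].cover) ∧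
      (∀ (j : ℕ) (_ : i < j) (hj : j < l.length), β ∈ l[j].start)
  cover_cured : ∀ β ∈ φ.closure, sim β ∉ m.cover →
    ∃ (i : ℕ) (hi : i + 1 < l.length), β ∈ l[i].finish

/-! ### Mosaics from structures -/

/-- The triple `mos(x, y)` of the structure `(T, <, h)`. -/
def mos {T : Type*} [LinearOrder T] (h : Atom → Set T) (φ : Formula Atom) (x y : T) :
    Triple Atom where
  start := {α | α ∈ φ.closure ∧ α.Sat h x}
  cover := {β | β ∈ φ.closure ∧ ∀ z, x < z → z < y → β.Sat h z}
  finish := {γ | γ ∈ φ.closure ∧ γ.Sat h y}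

/-- `m` is `T`-satisfiable, where `T` is a set of reals with the usual order. -/
def IsSatisfiableOn (T : Set ℝ) (φ : Formula Atom) (m : Triple Atom) : Prop :=
  ∃ (h : Atom → Set T) (x y : T), x < y ∧ m = mos h φ x y

/-! ### Tactics -/

/-- `m` is fully decomposed by the tactic `lead(σ)`. -/
def FullyDecomposedByLead (φ : Formula Atom) (m : Triple Atom) (σ : List (Triple Atom)) : Prop :=
  σ ≠ [] ∧ IsFullDecomposition φ (m :: σ) m

/-- `m` is fully decomposed by the tactic `trail(σ)`. -/
def FullyDecomposedByTrail (φ : Formula Atom) (m : Triple Atom) (σ : List (Triple Atom)) : Prop :=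
  σ ≠ [] ∧ IsFullDecomposition φ (σ ++ [m]) m

/-- The start of the first triple of a non-empty sequence. -/
def seqStart : List (Triple Atom) → Set (Formula Atom)
  | [] => ∅
  | m :: _ => m.start

/-- The end of the last triple of a non-empty sequence. -/
def seqStop : List (Triple Atom) → Set (Formula Atom)
  | [] => ∅
  | [m] => m.finish
  | _ :: m :: l => seqStop (m :: l)

/-- The parameters `P₀, …, Pₛ` and `λ₁, …, λᵣ` of a shuffle. Only the values `P i` with `i ≤ s`
and `lam i` with `1 ≤ i ≤ r` matter. -/
structure ShuffleData (Atom : Type*) where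
  s : ℕ
  r : ℕ
  P : ℕ → Set (Formula Atom)
  lam : ℕ → List (Triple Atom)

namespace ShuffleData

variable (D : ShuffleData Atom) (B : Set (Formula Atom))

/-- `yᵢ = (Pᵢ, B, Pᵢ₊₁)` for `i < s` and `yₛ = (Pₛ, B, P₀)`. -/
def y (i : ℕ) : Triple Atom :=
  ⟨D.P i, B, if i = D.s then D.P 0 else D.P (i + 1)⟩

/-- For `r > 0`: `x₀ = (P₀, B, A₁)`, `xᵢ = (Cᵢ, B, Aᵢ₊₁)` for `0 < i < r`, and `xᵣ = (Cᵣ, B, P₀)`,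
where `Aᵢ` is the start of the first and `Cᵢ` the end of the last mosaic of `λᵢ`. -/
def x (i : ℕ) : Triple Atom :=
  ⟨if i = 0 then D.P 0 else seqStop (D.lam i), B,
    if i = D.r then D.P 0 else seqStart (D.lam (i + 1))⟩

/-- The sequence `yᵢ, …, yⱼ` (for `i ≤ j`). -/
def ySeq (i j : ℕ) : List (Triple Atom) := (List.range' i (j + 1 - i)).map (D.y B)

/-- The sequence `μ = y₀, …, yₛ`. -/
def mu : List (Triple Atom) := D.ySeq B 0 D.s

/-- The sequence `λᵢ₊₁ ⌢ xᵢ₊₁ ⌢ … ⌢ λⱼ ⌢ xⱼ` (for `i ≤ j`; empty for `i = j`). -/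
def blocks (i j : ℕ) : List (Triple Atom) :=
  (List.range' (i + 1) (j - i)).flatMap fun k => D.lam k ++ [D.x B k]

/-- The sequence `λ`: empty for `r = 0`, and `x₀ ⌢ λ₁ ⌢ x₁ ⌢ … ⌢ λᵣ ⌢ xᵣ` otherwise. -/
def lamAll : List (Triple Atom) :=
  if D.r = 0 then [] else D.x B 0 :: D.blocks B 0 D.r

end ShuffleData

/-- The `φ`-mosaic `o = (A, B, C)` is fully decomposed by the tactic
`shuffle(⟨P₀, …, Pₛ⟩, ⟨λ₁, …, λᵣ⟩)`. -/
structure FullyDecomposedByShuffle (φ : Formula Atom) (o : Triple Atom) (D : ShuffleData Atom) :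
    Prop where
  mosaic : IsMosaic φ o
  mpc : ∀ i ≤ D.s, IsMPC φ (D.P i)
  lam_mosaic : ∀ i, 1 ≤ i → i ≤ D.r → ∀ m ∈ D.lam i, IsMosaic φ m
  lam_composes : ∀ i, 1 ≤ i → i ≤ D.r → ∃ m, ComposesTo (D.lam i) m
  first_mosaic : IsMosaic φ ⟨o.start, o.cover, D.P 0⟩
  last_mosaic : IsMosaic φ ⟨D.P 0, o.cover, o.finish⟩
  y_mosaic : ∀ i ≤ D.s, IsMosaic φ (D.y o.cover i)
  x_mosaic : 0 < D.r → ∀ i ≤ D.r, IsMosaic φ (D.x o.cover i)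
  f1 : IsFullDecomposition φ
    ([⟨o.start, o.cover, D.P 0⟩] ++ D.lamAll o.cover ++ D.mu o.cover ++
      [⟨D.P 0, o.cover, o.finish⟩]) o
  f2 : 0 < D.r → IsFullDecomposition φ
    (D.lamAll o.cover ++ D.mu o.cover ++ [D.x o.cover 0]) (D.x o.cover 0)
  f3 : ∀ i, 0 < i → i < D.r → IsFullDecomposition φ
    ([D.x o.cover i] ++ D.blocks o.cover i D.r ++ D.mu o.cover ++ [D.x o.cover 0] ++
      D.blocks o.cover 0 i) (D.x o.cover i)
  f4 : 0 < D.r → IsFullDecomposition φ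
    ([D.x o.cover D.r] ++ D.mu o.cover ++ D.lamAll o.cover) (D.x o.cover D.r)
  f5 : ∀ i < D.s, IsFullDecomposition φ
    (D.ySeq o.cover i D.s ++ D.lamAll o.cover ++ D.ySeq o.cover 0 i) (D.y o.cover i)
  f6 : IsFullDecomposition φ
    ([D.y o.cover D.s] ++ D.lamAll o.cover ++ D.mu o.cover) (D.y o.cover D.s)

/-! ### Real mosaic systems -/

/-- `m` is the composition of a sequence of mosaics, each of which either satisfies `Q` or is fully
decomposed by a tactic `lead(σ)` or `trail(σ)` with all mosaics of `σ` satisfying `Q`. -/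
def LeadTrailComposed (φ : Formula Atom) (Q : Triple Atom → Prop) (m : Triple Atom) : Prop :=
  ∃ l, IsDecomposition φ l m ∧ ∀ x ∈ l, Q x ∨
    ∃ σ : List (Triple Atom), (∀ y ∈ σ, Q y) ∧
      (FullyDecomposedByLead φ x σ ∨ FullyDecomposedByTrail φ x σ)

/-- `m` is the composition of a sequence of mosaics, each of which either satisfies `Q` or is fully
decomposed by a shuffle with all mosaics of all its sequences `λᵢ` satisfying `Q`. -/
def ShuffleComposed (φ : Formula Atom) (Q : Triple Atom → Prop) (m : Triple Atom) : Prop :=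
  ∃ l, IsDecomposition φ l m ∧ ∀ x ∈ l, Q x ∨
    ∃ D : ShuffleData Atom, FullyDecomposedByShuffle φ x D ∧
      ∀ i, 1 ≤ i → i ≤ D.r → ∀ y ∈ D.lam i, Q y

/-- Level `n⁻` members of `S`. There are none for `n = 0`; a level `(n+1)⁻` member is composed, by
way of leads and trails, of level `n⁺` members, and these in the same way of level `n` members. -/
def IsLevelMinus (φ : Formula Atom) (S : Set (Triple Atom)) : ℕ → Triple Atom → Prop
  | 0 => fun _ => False
  | n + 1 => LeadTrailComposed φ (LeadTrailComposed φ
      fun m => m ∈ S ∧ ShuffleComposed φ (IsLevelMinus φ S n) m)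

/-- Level `n` members of `S`. -/
def IsLevel (φ : Formula Atom) (S : Set (Triple Atom)) (n : ℕ) (m : Triple Atom) : Prop :=
  m ∈ S ∧ ShuffleComposed φ (IsLevelMinus φ S n) m

/-- Level `n⁺` members of `S`. -/
def IsLevelPlus (φ : Formula Atom) (S : Set (Triple Atom)) (n : ℕ) : Triple Atom → Prop :=
  LeadTrailComposed φ (IsLevel φ S n)

theorem isLevelMinus_succ (φ : Formula Atom) (S : Set (Triple Atom)) (n : ℕ) :
    IsLevelMinus φ S (n + 1) = LeadTrailComposed φ (IsLevelPlus φ S n) := rfl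

/-- `S` is a real mosaic system of `φ`-mosaics. -/
def IsRealMosaicSystem (φ : Formula Atom) (S : Set (Triple Atom)) : Prop :=
  (∀ m ∈ S, IsMosaic φ m) ∧ ∀ m ∈ S, ∃ n, IsLevel φ S n m

/-- `S` is a real mosaic system of `φ`-mosaics of depth `n`. -/
def IsRealMosaicSystemOfDepth (φ : Formula Atom) (S : Set (Triple Atom)) (n : ℕ) : Prop :=
  IsRealMosaicSystem φ S ∧ ∀ m ∈ S, IsLevel φ S n m

end

end RTL

/-!
The level of a mosaic is measured by its cover. In a fixed structure on `[0, 1]`, the mosaic between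
`x` and `y` has level `n` as soon as at most `n` formulas of the closure are missing from its cover
(`isLevel_mos`). The closure of a formula of length `L` has at most `2 * L` elements, which gives
the depth. As real mosaic system serve all mosaics of level `2 * L`: the mosaics used on the way
have lower level and therefore belong to the system (`isRealMosaicSystemOfDepth_isLevel_univ`).

The induction step (`IsMinimalCover.mos_shuffleComposed`) concerns an interval `[x, y]` with cover
`B`; the mosaics of its subintervals with a larger cover are already dealt with. A point `d` is left
critical if no `[u, d]` consists entirely of such mosaics; then all mosaics of `[x, y]` that end in
`d` have cover `B`. The key observation is that such an end demands nothing of the cover: if a Since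
is true at `d`, its second argument belongs to `B` (`snceCovered_truth`), and its first argument
either is settled by `B` or occurs arbitrarily close to `d`. The conditions on a mosaic split into
conditions on its start and on its end (`IsStart`, `IsFinish`). Hence the formulas true at any right
critical point, the cover `B`, and those true at any left critical point form a mosaic, and every
sequence composing to it in which all formulas not refuted by `B` occur is a full decomposition
(`isFullDecomposition_of_occurs`). There are two cases.

* Some limit of intervals composed by leads and trails is not itself so composed. Near this limit
  some set `A` of formulas is true at infinitely many points, and two of these give a sequence
  of mosaics from `A` back to `A` with cover `B`, a loop (`IsLoop`). A lead leads from every right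
  critical point to the loop, and a trail from the loop to every left critical point, wherever these
  points are; so a second round of leads and trails suffices for `[x, y]`
  (`IsMinimalCover.mos_of_isLoop`).
* Otherwise the maximal intervals composed by leads and trails are closed. If there is more than
  one, separability of the reals yields a point which is critical from both sides
  (`IsClosedRelation.exists_isolated`). The maximal intervals next to it begin in a left critical
  and end in a right critical point, and every formula not refuted by `B` occurs in one of them. So
  finitely many of them are the points and the blocks of a shuffle
  (`IsMinimalCover.shuffleComposed`).
-/

namespace RTL

variable {Atom : Type*}

open Formula

/-! ### The closure of a formula -/

theorem Formula.IsSubformula.refl (χ : Formula Atom) : IsSubformula χ χ := by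
  cases χ <;> simp [IsSubformula]

theorem Formula.IsSubformula.trans {χ θ φ : Formula Atom} (h₁ : IsSubformula χ θ)
    (h₂ : IsSubformula θ φ) : IsSubformula χ φ := by
  induction φ with
  | atom p => simp only [IsSubformula] at h₂; subst h₂; exact h₁
  | neg α ih =>
    rcases h₂ with rfl | h
    · exact h₁
    · exact Or.inr (ih h)
  | conj α β ihα ihβ =>
    rcases h₂ with rfl | h | h
    · exact h₁
    · exact Or.inr (Or.inl (ihα h))
    · exact Or.inr (Or.inr (ihβ h))
  | untl α β ihα ihβ =>
    rcases h₂ with rfl | h | h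
    · exact h₁
    · exact Or.inr (Or.inl (ihα h))
    · exact Or.inr (Or.inr (ihβ h))
  | snce α β ihα ihβ =>
    rcases h₂ with rfl | h | h
    · exact h₁
    · exact Or.inr (Or.inl (ihα h))
    · exact Or.inr (Or.inr (ihβ h))

theorem finite_subformulas_and_ncard_le (φ : Formula Atom) :
    {χ | IsSubformula χ φ}.Finite ∧ {χ | IsSubformula χ φ}.ncard ≤ φ.length := by
  have binary : ∀ {X Y : Set (Formula Atom)} {a b : ℕ} (θ : Formula Atom),
      X.Finite ∧ X.ncard ≤ a → Y.Finite ∧ Y.ncard ≤ b →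
      (insert θ (X ∪ Y)).Finite ∧ (insert θ (X ∪ Y)).ncard ≤ a + b + 1 := by
    intro X Y a b θ hX hY
    refine ⟨(hX.1.union hY.1).insert _, (Set.ncard_insert_le _ _).trans ?_⟩
    have := Set.ncard_union_le X Y
    lia
  induction φ with
  | atom p =>
    have : {χ | IsSubformula χ (atom p)} = {atom p} := by ext; simp [IsSubformula]
    rw [this]
    simp [length]
  | neg α ih =>
    have : {χ | IsSubformula χ (neg α)} = insert (neg α) {χ | IsSubformula χ α} := by
      ext; simp [IsSubformula]
    rw [this]
    exact ⟨ih.1.insert _, (Set.ncard_insert_le _ _).trans (by simpa [length] using ih.2)⟩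
  | conj α β ihα ihβ =>
    have : {χ | IsSubformula χ (conj α β)} =
        insert (conj α β) ({χ | IsSubformula χ α} ∪ {χ | IsSubformula χ β}) := by
      ext; simp [IsSubformula]
    rw [this]
    exact binary _ ihα ihβ
  | untl α β ihα ihβ =>
    have : {χ | IsSubformula χ (untl α β)} =
        insert (untl α β) ({χ | IsSubformula χ α} ∪ {χ | IsSubformula χ β}) := by
      ext; simp [IsSubformula]
    rw [this]
    exact binary _ ihα ihβ
  | snce α β ihα ihβ =>
    have : {χ | IsSubformula χ (snce α β)} =
        insert (snce α β) ({χ | IsSubformula χ α} ∪ {χ | IsSubformula χ β}) := by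
      ext; simp [IsSubformula]
    rw [this]
    exact binary _ ihα ihβ

theorem closure_eq_union (φ : Formula Atom) :
    φ.closure = {χ | IsSubformula χ φ} ∪ neg '' {χ | IsSubformula χ φ} := by
  ext χ
  simp only [Formula.closure, Set.mem_ofPred_eq, Set.mem_union, Set.mem_image]
  exact or_congr_right (exists_congr fun α => and_congr_right fun _ => eq_comm)

theorem closure_finite (φ : Formula Atom) : φ.closure.Finite := by
  rw [closure_eq_union]
  have := (finite_subformulas_and_ncard_le φ).1
  exact this.union (this.image _)

theorem closure_ncard_le (φ : Formula Atom) : φ.closure.ncard ≤ 2 * φ.length := by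
  rw [closure_eq_union]
  obtain ⟨hf, hle⟩ := finite_subformulas_and_ncard_le φ
  have h₁ := Set.ncard_union_le {χ | IsSubformula χ φ} (neg '' {χ | IsSubformula χ φ})
  have h₂ := Set.ncard_image_le (f := neg) hf
  lia

theorem mem_closure_of_isSubformula {χ φ : Formula Atom} (h : IsSubformula χ φ) :
    χ ∈ φ.closure := Or.inl h

theorem neg_mem_closure_of_isSubformula {χ φ : Formula Atom} (h : IsSubformula χ φ) :
    neg χ ∈ φ.closure := Or.inr ⟨χ, h, rfl⟩

theorem isSubformula_of_neg_mem_closure {χ φ : Formula Atom} (h : neg χ ∈ φ.closure) :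
    IsSubformula χ φ := by
  rcases h with h | ⟨α, hα, he⟩
  · exact IsSubformula.trans (θ := neg χ) (Or.inr (IsSubformula.refl χ)) h
  · rw [Formula.neg.inj he]
    exact hα

theorem isSubformula_of_untl {α β φ : Formula Atom} (h : IsSubformula (untl α β) φ) :
    IsSubformula α φ ∧ IsSubformula β φ :=
  ⟨IsSubformula.trans (θ := untl α β) (Or.inr (Or.inl (IsSubformula.refl α))) h,
    IsSubformula.trans (θ := untl α β) (Or.inr (Or.inr (IsSubformula.refl β))) h⟩

theorem isSubformula_of_snce {α β φ : Formula Atom} (h : IsSubformula (snce α β) φ) :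
    IsSubformula α φ ∧ IsSubformula β φ :=
  ⟨IsSubformula.trans (θ := snce α β) (Or.inr (Or.inl (IsSubformula.refl α))) h,
    IsSubformula.trans (θ := snce α β) (Or.inr (Or.inr (IsSubformula.refl β))) h⟩

theorem isSubformula_untl_of_mem {α β φ : Formula Atom} (h : untl α β ∈ φ.closure) :
    IsSubformula (untl α β) φ := by
  rcases h with h | ⟨_, _, he⟩
  · exact h
  · cases he

theorem isSubformula_snce_of_mem {α β φ : Formula Atom} (h : snce α β ∈ φ.closure) :
    IsSubformula (snce α β) φ := by
  rcases h with h | ⟨_, _, he⟩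
  · exact h
  · cases he

/-! ### Compositions and decompositions -/

theorem ComposesTo.ne_nil {l : List (Triple Atom)} {m : Triple Atom} (h : ComposesTo l m) :
    l ≠ [] := by
  cases h <;> simp

theorem ComposesTo.start_eq {l : List (Triple Atom)} {m : Triple Atom} (h : ComposesTo l m) :
    seqStart l = m.start := by
  cases h <;> rfl

theorem ComposesTo.finish_eq {l : List (Triple Atom)} {m : Triple Atom} (h : ComposesTo l m) :
    seqStop l = m.finish := by
  induction h with
  | single m => rfl
  | cons m m' l hl he ih =>
    cases l with
    | nil => exact absurd rfl hl.ne_nil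
    | cons a l => exact ih

theorem ComposesTo.append {l₁ l₂ : List (Triple Atom)} {m₁ m₂ : Triple Atom}
    (h₁ : ComposesTo l₁ m₁) (h₂ : ComposesTo l₂ m₂) (h : m₁.finish = m₂.start) :
    ComposesTo (l₁ ++ l₂) ⟨m₁.start, m₁.cover ∩ m₁.finish ∩ m₂.cover, m₂.finish⟩ := by
  induction h₁ with
  | single m => exact .cons m m₂ l₂ h₂ h
  | cons m m' l hl he ih =>
    have := ComposesTo.cons m _ _ (ih h) he
    simpa only [List.cons_append, Set.inter_assoc] using this

theorem ComposesTo.pair {m₁ m₂ : Triple Atom} (h : m₁.finish = m₂.start) :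
    ComposesTo [m₁, m₂] ⟨m₁.start, m₁.cover ∩ m₁.finish ∩ m₂.cover, m₂.finish⟩ :=
  .cons m₁ m₂ _ (.single m₂) h

/-- Replacing every member of a composing sequence by a sequence that composes to it does not
change the composition. -/
theorem ComposesTo.flatMap {l : List (Triple Atom)} {m : Triple Atom} (h : ComposesTo l m)
    {f : Triple Atom → List (Triple Atom)} (hf : ∀ x ∈ l, ComposesTo (f x) x) :
    ComposesTo (l.flatMap f) m := by
  induction h with
  | single m => simpa using hf m (by simp)
  | cons m m' l hl he ih =>
    rw [List.flatMap_cons]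
    exact (hf m (by simp)).append (ih fun x hx => hf x (by simp [hx])) he

theorem ComposesTo.cover_subset {l : List (Triple Atom)} {m : Triple Atom} (h : ComposesTo l m) :
    ∀ x ∈ l, m.cover ⊆ x.cover := by
  induction h with
  | single m => simp
  | cons m m' l hl he ih =>
    intro x hx
    rcases List.mem_cons.1 hx with rfl | hx
    · exact fun a ha => ha.1.1
    · exact fun a ha => ih x hx ha.2

theorem ComposesTo.cover_subset_finish {l : List (Triple Atom)} {m : Triple Atom}
    (h : ComposesTo l m) : ∀ (i : ℕ) (hi : i + 1 < l.length), m.cover ⊆ l[i].finish := by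
  induction h with
  | single m => simp
  | cons m m' l hl he ih =>
    intro i hi
    cases i with
    | zero => exact fun a ha => ha.1.2
    | succ i => exact fun a ha => ih i (by simpa using hi) ha.2

theorem ComposesTo.finish_eq_start {l : List (Triple Atom)} {m : Triple Atom}
    (h : ComposesTo l m) :
    ∀ (i : ℕ) (hi : i + 1 < l.length), l[i].finish = l[i + 1].start := by
  induction h with
  | single m => simp
  | cons m m' l hl he ih =>
    intro i hi
    cases i with
    | zero =>
      cases hl with
      | single => exact he
      | cons => exact he
    | succ i => exact ih i (by simpa using hi)

/-- Criterion for a decomposition to be full. An Until at the start needs an explicit cure only if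
its second argument is not in the cover: otherwise condition `c2` on `m`, or the occurrence of its
first argument somewhere inside the sequence, cures it. -/
theorem isFullDecomposition_of_occurs {φ : Formula Atom} {l : List (Triple Atom)}
    {m : Triple Atom} (hm : IsMosaic φ m) (hl : ∀ x ∈ l, IsMosaic φ x) (hc : ComposesTo l m)
    (hU : ∀ α β, untl α β ∈ m.start → β ∈ m.cover ∨
      ∃ (i : ℕ) (hi : i + 1 < l.length), α ∈ l[i].finish ∧
        (∀ (j : ℕ) (hj : j ≤ i), β ∈ l[j].cover) ∧ (∀ (j : ℕ) (hj : j < i), β ∈ l[j].finish))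
    (hS : ∀ α β, snce α β ∈ m.finish → β ∈ m.cover ∨
      ∃ (i : ℕ) (_ : 0 < i) (hi : i < l.length), α ∈ l[i].start ∧
        (∀ (j : ℕ) (_ : i ≤ j) (hj : j < l.length), β ∈ l[j].cover) ∧
        (∀ (j : ℕ) (_ : i < j) (hj : j < l.length), β ∈ l[j].start))
    (hW : ∀ β ∈ φ.closure, sim β ∉ m.cover →
      ∃ (i : ℕ) (hi : i + 1 < l.length), β ∈ l[i].finish) :
    IsFullDecomposition φ l m where
  decomposition := ⟨hm, hl, hc⟩
  untl_cured α β h := by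
    rcases hU α β h with hβ | hcure
    · by_cases hα : neg α ∈ m.cover
      · exact Or.inl ⟨hβ, (hm.c2 α β h hα).1.symm⟩
      · have hsub := (isSubformula_of_untl (isSubformula_untl_of_mem (hm.start_mpc.1.1 h))).1
        have hcl := mem_closure_of_isSubformula hsub
        rw [hm.neg_iff_sim α hcl (neg_mem_closure_of_isSubformula hsub)] at hα
        obtain ⟨i, hi, hαi⟩ := hW α hcl hα
        exact Or.inr ⟨i, hi, hαi, fun j hj => hc.cover_subset _ (List.getElem_mem _) hβ,
          fun j hj => hc.cover_subset_finish j (by lia) hβ⟩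
    · exact Or.inr hcure
  snce_cured α β h := by
    rcases hS α β h with hβ | hcure
    · by_cases hα : neg α ∈ m.cover
      · exact Or.inl ⟨hβ, (hm.c4 α β h hα).1.symm⟩
      · have hsub := (isSubformula_of_snce (isSubformula_snce_of_mem (hm.finish_mpc.1.1 h))).1
        have hcl := mem_closure_of_isSubformula hsub
        rw [hm.neg_iff_sim α hcl (neg_mem_closure_of_isSubformula hsub)] at hα
        obtain ⟨i, hi, hαi⟩ := hW α hcl hα
        refine Or.inr ⟨i + 1, i.succ_pos, hi, hc.finish_eq_start i hi ▸ hαi,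
          fun j _ hj => hc.cover_subset _ (List.getElem_mem _) hβ, fun j hij hj => ?_⟩
        obtain ⟨k, rfl⟩ : ∃ k, j = k + 1 := ⟨j - 1, by lia⟩
        exact hc.finish_eq_start k hj ▸ hc.cover_subset_finish k hj hβ
    · exact Or.inr hcure
  cover_cured := hW

/-! ### Closure properties of the levels -/

/-- The property `Q` passes from the members of a composing sequence to every mosaic which the
sequence composes to. -/
def IsCompositional (φ : Formula Atom) (Q : Triple Atom → Prop) : Prop :=
  ∀ l m, ComposesTo l m → IsMosaic φ m → (∀ x ∈ l, Q x) → Q m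

theorem isCompositional_of_decomposition {φ : Formula Atom} {R : Triple Atom → Prop} :
    IsCompositional φ fun m => ∃ l, IsDecomposition φ l m ∧ ∀ x ∈ l, R x := by
  intro l m hc hm hl
  choose! f hf using hl
  refine ⟨l.flatMap f, ⟨hm, ?_, hc.flatMap fun x hx => (hf x hx).1.2.2⟩, ?_⟩
  · intro y hy
    obtain ⟨x, hx, hy⟩ := List.mem_flatMap.1 hy
    exact (hf x hx).1.2.1 y hy
  · intro y hy
    obtain ⟨x, hx, hy⟩ := List.mem_flatMap.1 hy
    exact (hf x hx).2 y hy

theorem isCompositional_leadTrailComposed (φ : Formula Atom) (Q : Triple Atom → Prop) :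
    IsCompositional φ (LeadTrailComposed φ Q) :=
  isCompositional_of_decomposition

theorem isCompositional_shuffleComposed (φ : Formula Atom) (Q : Triple Atom → Prop) :
    IsCompositional φ (ShuffleComposed φ Q) :=
  isCompositional_of_decomposition

theorem isDecomposition_singleton {φ : Formula Atom} {m : Triple Atom} (hm : IsMosaic φ m) :
    IsDecomposition φ [m] m :=
  ⟨hm, by simpa using hm, .single m⟩

theorem LeadTrailComposed.of_mem {φ : Formula Atom} {Q : Triple Atom → Prop} {m : Triple Atom}
    (hm : IsMosaic φ m) (h : Q m) : LeadTrailComposed φ Q m :=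
  ⟨[m], isDecomposition_singleton hm, by simp [h]⟩

theorem ShuffleComposed.of_mem {φ : Formula Atom} {Q : Triple Atom → Prop} {m : Triple Atom}
    (hm : IsMosaic φ m) (h : Q m) : ShuffleComposed φ Q m :=
  ⟨[m], isDecomposition_singleton hm, by simp [h]⟩

theorem LeadTrailComposed.mono {φ : Formula Atom} {Q Q' : Triple Atom → Prop}
    (h : ∀ m, Q m → Q' m) {m : Triple Atom} (hm : LeadTrailComposed φ Q m) :
    LeadTrailComposed φ Q' m := by
  obtain ⟨l, hl, hx⟩ := hm
  refine ⟨l, hl, fun x hxl => (hx x hxl).imp (h x) ?_⟩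
  rintro ⟨σ, hσ, ht⟩
  exact ⟨σ, fun y hy => h y (hσ y hy), ht⟩

theorem ShuffleComposed.mono {φ : Formula Atom} {Q Q' : Triple Atom → Prop}
    (h : ∀ m, Q m → Q' m) {m : Triple Atom} (hm : ShuffleComposed φ Q m) :
    ShuffleComposed φ Q' m := by
  obtain ⟨l, hl, hx⟩ := hm
  refine ⟨l, hl, fun x hxl => (hx x hxl).imp (h x) ?_⟩
  rintro ⟨D, hD, hlam⟩
  exact ⟨D, hD, fun i h₁ h₂ y hy => h y (hlam i h₁ h₂ y hy)⟩

theorem IsLevel.isMosaic {φ : Formula Atom} {S : Set (Triple Atom)} {n : ℕ} {m : Triple Atom}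
    (h : IsLevel φ S n m) : IsMosaic φ m := by
  obtain ⟨-, l, hl, -⟩ := h
  exact hl.1

theorem IsLevel.succ {φ : Formula Atom} {S : Set (Triple Atom)} {n : ℕ} {m : Triple Atom}
    (h : IsLevel φ S n m) : IsLevel φ S (n + 1) m :=
  ⟨h.1, .of_mem h.isMosaic (.of_mem h.isMosaic (.of_mem h.isMosaic h))⟩

theorem IsLevel.mono {φ : Formula Atom} {S : Set (Triple Atom)} {n k : ℕ} (hnk : n ≤ k)
    {m : Triple Atom} (h : IsLevel φ S n m) : IsLevel φ S k m := by
  induction hnk with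
  | refl => exact h
  | step _ ih => exact ih.succ

/-- The mosaics of level `N` among all mosaics form a real mosaic system of depth `N`: the members
used to show that a mosaic has level `N` have level at most `N` themselves. -/
theorem isRealMosaicSystemOfDepth_isLevel_univ (φ : Formula Atom) (N : ℕ) :
    IsRealMosaicSystemOfDepth φ {m | IsLevel φ Set.univ N m} N := by
  have key : ∀ n ≤ N, (∀ m, IsLevelMinus φ Set.univ n m →
        IsLevelMinus φ {m | IsLevel φ Set.univ N m} n m) ∧
      ∀ m, IsLevel φ Set.univ n m → IsLevel φ {m | IsLevel φ Set.univ N m} n m := by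
    intro n
    induction n with
    | zero => exact fun _ => ⟨fun m h => h, fun m h => ⟨h.mono (Nat.zero_le _), h.2⟩⟩
    | succ n ih =>
      intro hn
      have hminus : ∀ m, IsLevelMinus φ Set.univ (n + 1) m →
          IsLevelMinus φ {m | IsLevel φ Set.univ N m} (n + 1) m :=
        fun m h => LeadTrailComposed.mono
          (fun x hx => LeadTrailComposed.mono (ih (by lia)).2 hx) h
      exact ⟨hminus, fun m h => ⟨h.mono hn, h.2.mono hminus⟩⟩
  exact ⟨⟨fun m h => h.isMosaic, fun m h => ⟨N, (key N le_rfl).2 m h⟩⟩,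
    fun m h => (key N le_rfl).2 m h⟩

/-! ### The set of formulas true at a point -/

section Semantics

variable {T : Type*} [LinearOrder T] (h : Atom → Set T) (φ : Formula Atom)

/-- The formulas of the closure of `φ` that are true at `x`. -/
def truth (x : T) : Set (Formula Atom) := {α | α ∈ φ.closure ∧ α.Sat h x}

/-- The formulas of the closure of `φ` that are true throughout the open interval `(x, y)`. -/
def intervalTruth (x y : T) : Set (Formula Atom) :=
  {β | β ∈ φ.closure ∧ ∀ z, x < z → z < y → β.Sat h z}

theorem mos_eq (x y : T) :
    mos h φ x y = ⟨truth h φ x, intervalTruth h φ x y, truth h φ y⟩ := rfl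

variable {h φ}

theorem sat_sim_iff (α : Formula Atom) (x : T) : (sim α).Sat h x ↔ ¬ α.Sat h x := by
  cases α <;> simp [sim, Sat]

theorem sat_subst_iff (a : PropFormula) (f : ℕ → Formula Atom) (x : T) :
    (a.subst f).Sat h x ↔ a.Eval fun i => (f i).Sat h x := by
  induction a with
  | var i => rfl
  | neg a ih => exact not_congr ih
  | conj a b iha ihb => exact and_congr iha ihb

theorem sat_conjList (α : Formula Atom) (l : List (Formula Atom)) (x : T)
    (hα : α.Sat h x) (hl : ∀ β ∈ l, β.Sat h x) : (conjList α l).Sat h x := by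
  induction l generalizing α with
  | nil => exact hα
  | cons β l ih => exact ⟨hα, ih β (hl β (by simp)) fun γ hγ => hl γ (by simp [hγ])⟩

/-- A propositionally consistent set cannot contain both a formula and its negation. -/
theorem PropConsistent.not_mem_neg {X : Set (Formula Atom)} (hX : PropConsistent X)
    {α : Formula Atom} (hα : α ∈ X) : neg α ∉ X := by
  intro hn
  refine hX α [neg α] hα (by simpa using hn) ?_
  refine ⟨.neg (.conj (.var 0) (.neg (.var 0))), fun v hv => ?_, fun _ => α, rfl⟩
  exact hv.2 hv.1

theorem isMPC_truth (x : T) : IsMPC φ (truth h φ x) := by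
  refine ⟨⟨fun α hα => hα.1, ?_⟩, ?_⟩
  · rintro α l hα hl ⟨a, ha, f, hf⟩
    have h₁ : (neg (conjList α l)).Sat h x := by
      rw [← hf, sat_subst_iff]
      exact ha _
    exact h₁ (sat_conjList α l x hα.2 fun β hβ => (hl β hβ).2)
  · rintro Y ⟨hY, hcons⟩ hle χ hχ
    refine ⟨hY hχ, ?_⟩
    by_contra hns
    rcases hY hχ with hsub | ⟨α, hα, rfl⟩
    · exact hcons.not_mem_neg hχ (hle ⟨neg_mem_closure_of_isSubformula hsub, hns⟩)
    · exact hcons.not_mem_neg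
        (hle ⟨mem_closure_of_isSubformula hα, not_not.1 hns⟩) hχ

theorem intervalTruth_anti {x x' y y' : T} (hx : x ≤ x') (hy : y' ≤ y) :
    intervalTruth h φ x y ⊆ intervalTruth h φ x' y' :=
  fun _ hβ => ⟨hβ.1, fun z h₁ h₂ => hβ.2 z (hx.trans_lt h₁) (h₂.trans_le hy)⟩

theorem intervalTruth_subset_truth {x y z : T} (h₁ : x < z) (h₂ : z < y) :
    intervalTruth h φ x y ⊆ truth h φ z :=
  fun _ hβ => ⟨hβ.1, hβ.2 z h₁ h₂⟩

theorem intervalTruth_eq_inter {x y z : T} (h₁ : x < z) (h₂ : z < y) :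
    intervalTruth h φ x y =
      intervalTruth h φ x z ∩ truth h φ z ∩ intervalTruth h φ z y := by
  ext β
  constructor
  · intro hβ
    exact ⟨⟨intervalTruth_anti le_rfl h₂.le hβ, intervalTruth_subset_truth h₁ h₂ hβ⟩,
      intervalTruth_anti h₁.le le_rfl hβ⟩
  · rintro ⟨⟨hβ₁, hβ₂⟩, hβ₃⟩
    refine ⟨hβ₁.1, fun w hw₁ hw₂ => ?_⟩
    rcases lt_trichotomy w z with hw | rfl | hw
    · exact hβ₁.2 w hw₁ hw
    · exact hβ₂.2
    · exact hβ₃.2 w hw hw₂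

theorem composesTo_mos_pair {x y z : T} (h₁ : x < z) (h₂ : z < y) :
    ComposesTo [mos h φ x z, mos h φ z y] (mos h φ x y) := by
  rw [mos_eq h φ x y, intervalTruth_eq_inter h₁ h₂]
  exact ComposesTo.pair rfl

/-! ### The two halves of the definition of a mosaic -/

variable (φ)

/-- The conditions on a mosaic with cover `B` that concern its start `A` only. -/
structure IsStart (B A : Set (Formula Atom)) : Prop where
  mpc : IsMPC φ A
  untl : ∀ α β, untl α β ∈ A → neg α ∈ B → β ∈ B ∧ Formula.untl α β ∈ B
  neg_untl : ∀ α β, neg (Formula.untl α β) ∈ A → β ∈ B →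
    neg α ∈ B ∧ neg (Formula.untl α β) ∈ B
  snce : ∀ α β, neg α ∈ B → Formula.snce α β ∈ B → α ∈ A ∨ (β ∈ A ∧ Formula.snce α β ∈ A)
  neg_snce : ∀ α β, β ∈ B → neg α ∈ B → neg (Formula.snce α β) ∈ B →
    neg α ∈ A ∧ (neg β ∈ A ∨ neg (Formula.snce α β) ∈ A)

/-- The conditions on a mosaic with cover `B` that concern its end `C` only. -/
structure IsFinish (B C : Set (Formula Atom)) : Prop where
  mpc : IsMPC φ C
  snce : ∀ α β, snce α β ∈ C → neg α ∈ B → β ∈ B ∧ Formula.snce α β ∈ B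
  neg_snce : ∀ α β, neg (Formula.snce α β) ∈ C → β ∈ B →
    neg α ∈ B ∧ neg (Formula.snce α β) ∈ B
  untl : ∀ α β, neg α ∈ B → Formula.untl α β ∈ B → α ∈ C ∨ (β ∈ C ∧ Formula.untl α β ∈ C)
  neg_untl : ∀ α β, β ∈ B → neg α ∈ B → neg (Formula.untl α β) ∈ B →
    neg α ∈ C ∧ (neg β ∈ C ∨ neg (Formula.untl α β) ∈ C)

/-- The conditions on a mosaic that concern its cover only. -/
structure IsCover (B : Set (Formula Atom)) : Prop where
  subset : B ⊆ φ.closure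
  neg_iff_sim : ∀ β, β ∈ φ.closure → neg β ∈ φ.closure → (neg β ∈ B ↔ sim β ∈ B)

variable {φ}

theorem isMosaic_of_isStart_isFinish {A B C : Set (Formula Atom)} (hB : IsCover φ B)
    (hA : IsStart φ B A) (hC : IsFinish φ B C) : IsMosaic φ ⟨A, B, C⟩ where
  cover_subset := hB.subset
  start_mpc := hA.mpc
  finish_mpc := hC.mpc
  neg_iff_sim := hB.neg_iff_sim
  c1 α β h₁ h₂ :=
    have h₃ := hA.neg_untl α β h₁ h₂
    ⟨hC.neg_untl α β h₂ h₃.1 h₃.2, h₃⟩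
  c2 α β h₁ h₂ :=
    have h₃ := hA.untl α β h₁ h₂
    ⟨hC.untl α β h₂ h₃.2, h₃⟩
  c3 α β h₁ h₂ :=
    have h₃ := hC.neg_snce α β h₁ h₂
    ⟨hA.neg_snce α β h₂ h₃.1 h₃.2, h₃⟩
  c4 α β h₁ h₂ :=
    have h₃ := hC.snce α β h₁ h₂
    ⟨hA.snce α β h₂ h₃.2, h₃⟩

theorem isCover_intervalTruth (x y : T) : IsCover φ (intervalTruth h φ x y) where
  subset _ hβ := hβ.1
  neg_iff_sim β _ hn := by
    have hsim : sim β ∈ φ.closure := by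
      cases β with
      | neg γ =>
        exact mem_closure_of_isSubformula (IsSubformula.trans (θ := neg γ)
          (Or.inr (IsSubformula.refl γ)) (isSubformula_of_neg_mem_closure hn))
      | _ => exact hn
    refine ⟨fun hβ => ⟨hsim, fun z h₁ h₂ => (sat_sim_iff β z).2 (hβ.2 z h₁ h₂)⟩,
      fun hβ => ⟨hn, fun z h₁ h₂ => (sat_sim_iff β z).1 (hβ.2 z h₁ h₂)⟩⟩

theorem isStart_truth [DenselyOrdered T] {x y : T} (hxy : x < y) :
    IsStart φ (intervalTruth h φ x y) (truth h φ x) where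
  mpc := isMPC_truth x
  untl := by
    rintro α β ⟨hcl, w, hxw, hαw, hβw⟩ hα
    have hyw : y ≤ w := not_lt.1 fun hwy => hα.2 w hxw hwy hαw
    have hβ := mem_closure_of_isSubformula (isSubformula_of_untl (isSubformula_untl_of_mem hcl)).2
    exact ⟨⟨hβ, fun z h₁ h₂ => hβw z h₁ (h₂.trans_le hyw)⟩, hcl, fun z h₁ h₂ =>
      ⟨w, h₂.trans_le hyw, hαw, fun v h₃ h₄ => hβw v (h₁.trans h₃) h₄⟩⟩
  neg_untl := by
    rintro α β ⟨hcl, hU⟩ hβ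
    have hα := (isSubformula_of_untl (isSubformula_of_neg_mem_closure hcl)).1
    refine ⟨⟨neg_mem_closure_of_isSubformula hα, fun z h₁ h₂ hz =>
      hU ⟨z, h₁, hz, fun v h₃ h₄ => hβ.2 v h₃ (h₄.trans h₂)⟩⟩, hcl, ?_⟩
    rintro z h₁ h₂ ⟨w, hzw, hαw, hβw⟩
    refine hU ⟨w, h₁.trans hzw, hαw, fun v h₃ h₄ => ?_⟩
    rcases lt_or_ge z v with hv | hv
    · exact hβw v hv h₄
    · exact hβ.2 v h₃ (hv.trans_lt h₂)
  snce := by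
    rintro α β hα ⟨hcl, hS⟩
    have hsub := isSubformula_of_snce (isSubformula_snce_of_mem hcl)
    obtain ⟨z, h₁, h₂⟩ := exists_between hxy
    obtain ⟨w, hwz, hαw, hβw⟩ := hS z h₁ h₂
    rcases lt_trichotomy x w with hw | rfl | hw
    · exact absurd hαw (hα.2 w hw (hwz.trans h₂))
    · exact Or.inl ⟨mem_closure_of_isSubformula hsub.1, hαw⟩
    · exact Or.inr ⟨⟨mem_closure_of_isSubformula hsub.2, hβw x hw h₁⟩, hcl, w, hw, hαw,
        fun v h₃ h₄ => hβw v h₃ (h₄.trans h₁)⟩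
  neg_snce := by
    rintro α β hβ hα ⟨hcl, hS⟩
    have hsub := isSubformula_of_neg_mem_closure hcl
    have hsub' := isSubformula_of_snce hsub
    obtain ⟨z, h₁, h₂⟩ := exists_between hxy
    have hz := hS z h₁ h₂
    refine ⟨⟨neg_mem_closure_of_isSubformula hsub'.1, fun hx =>
      hz ⟨x, h₁, hx, fun v h₃ h₄ => hβ.2 v h₃ (h₄.trans h₂)⟩⟩, ?_⟩
    by_cases hβx : β.Sat h x
    · refine Or.inr ⟨hcl, ?_⟩
      rintro ⟨w, hwx, hαw, hβw⟩
      refine hz ⟨w, hwx.trans h₁, hαw, fun v h₃ h₄ => ?_⟩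
      rcases lt_trichotomy x v with hv | rfl | hv
      · exact hβ.2 v hv (h₄.trans h₂)
      · exact hβx
      · exact hβw v h₃ hv
    · exact Or.inl ⟨neg_mem_closure_of_isSubformula hsub'.2, hβx⟩

theorem isFinish_truth [DenselyOrdered T] {x y : T} (hxy : x < y) :
    IsFinish φ (intervalTruth h φ x y) (truth h φ y) where
  mpc := isMPC_truth y
  snce := by
    rintro α β ⟨hcl, w, hwy, hαw, hβw⟩ hα
    have hwx : w ≤ x := not_lt.1 fun hxw => hα.2 w hxw hwy hαw
    have hβ := mem_closure_of_isSubformula (isSubformula_of_snce (isSubformula_snce_of_mem hcl)).2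
    exact ⟨⟨hβ, fun z h₁ h₂ => hβw z (hwx.trans_lt h₁) h₂⟩, hcl, fun z h₁ h₂ =>
      ⟨w, hwx.trans_lt h₁, hαw, fun v h₃ h₄ => hβw v h₃ (h₄.trans h₂)⟩⟩
  neg_snce := by
    rintro α β ⟨hcl, hS⟩ hβ
    have hα := (isSubformula_of_snce (isSubformula_of_neg_mem_closure hcl)).1
    refine ⟨⟨neg_mem_closure_of_isSubformula hα, fun z h₁ h₂ hz =>
      hS ⟨z, h₂, hz, fun v h₃ h₄ => hβ.2 v (h₁.trans h₃) h₄⟩⟩, hcl, ?_⟩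
    rintro z h₁ h₂ ⟨w, hwz, hαw, hβw⟩
    refine hS ⟨w, hwz.trans h₂, hαw, fun v h₃ h₄ => ?_⟩
    rcases lt_or_ge v z with hv | hv
    · exact hβw v h₃ hv
    · exact hβ.2 v (h₁.trans_le hv) h₄
  untl := by
    rintro α β hα ⟨hcl, hU⟩
    have hsub := isSubformula_of_untl (isSubformula_untl_of_mem hcl)
    obtain ⟨z, h₁, h₂⟩ := exists_between hxy
    obtain ⟨w, hzw, hαw, hβw⟩ := hU z h₁ h₂
    rcases lt_trichotomy w y with hw | rfl | hw
    · exact absurd hαw (hα.2 w (h₁.trans hzw) hw)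
    · exact Or.inl ⟨mem_closure_of_isSubformula hsub.1, hαw⟩
    · exact Or.inr ⟨⟨mem_closure_of_isSubformula hsub.2, hβw y h₂ hw⟩, hcl, w, hw, hαw,
        fun v h₃ h₄ => hβw v (h₂.trans h₃) h₄⟩
  neg_untl := by
    rintro α β hβ hα ⟨hcl, hU⟩
    have hsub := isSubformula_of_neg_mem_closure hcl
    have hsub' := isSubformula_of_untl hsub
    obtain ⟨z, h₁, h₂⟩ := exists_between hxy
    have hz := hU z h₁ h₂
    refine ⟨⟨neg_mem_closure_of_isSubformula hsub'.1, fun hy =>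
      hz ⟨y, h₂, hy, fun v h₃ h₄ => hβ.2 v (h₁.trans h₃) h₄⟩⟩, ?_⟩
    by_cases hβy : β.Sat h y
    · refine Or.inr ⟨hcl, ?_⟩
      rintro ⟨w, hyw, hαw, hβw⟩
      refine hz ⟨w, h₂.trans hyw, hαw, fun v h₃ h₄ => ?_⟩
      rcases lt_trichotomy v y with hv | rfl | hv
      · exact hβ.2 v (h₁.trans h₃) hv
      · exact hβy
      · exact hβw v hv h₄
    · exact Or.inl ⟨neg_mem_closure_of_isSubformula hsub'.2, hβy⟩

theorem isMosaic_mos [DenselyOrdered T] {x y : T} (hxy : x < y) : IsMosaic φ (mos h φ x y) :=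
  isMosaic_of_isStart_isFinish (isCover_intervalTruth x y) (isStart_truth hxy)
    (isFinish_truth hxy)

/-- `B` contains the second argument of every Until in `A`. For the set `A` of formulas true at
`x`, this holds if `B` is the set of formulas true throughout `(x, y)` for `y > x` arbitrarily
close to `x`. -/
def UntlCovered (B A : Set (Formula Atom)) : Prop := ∀ α β, untl α β ∈ A → β ∈ B

/-- `B` contains the second argument of every Since in `C`; the mirror image of `UntlCovered`. -/
def SnceCovered (B C : Set (Formula Atom)) : Prop := ∀ α β, snce α β ∈ C → β ∈ B

theorem untlCovered_truth {B : Set (Formula Atom)} {x y : T} (hxy : x < y)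
    (hB : ∀ v, x < v → v ≤ y → intervalTruth h φ x v = B) : UntlCovered B (truth h φ x) := by
  rintro α β ⟨hcl, w, hxw, -, hβw⟩
  rw [← hB (min w y) (lt_min hxw hxy) (min_le_right _ _)]
  exact ⟨mem_closure_of_isSubformula (isSubformula_of_untl (isSubformula_untl_of_mem hcl)).2,
    fun z h₁ h₂ => hβw z h₁ (h₂.trans_le (min_le_left _ _))⟩

theorem snceCovered_truth {B : Set (Formula Atom)} {x y : T} (hxy : x < y)
    (hB : ∀ v, x ≤ v → v < y → intervalTruth h φ v y = B) : SnceCovered B (truth h φ y) := by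
  rintro α β ⟨hcl, w, hwy, -, hβw⟩
  rw [← hB (max w x) (le_max_right _ _) (max_lt hwy hxy)]
  exact ⟨mem_closure_of_isSubformula (isSubformula_of_snce (isSubformula_snce_of_mem hcl)).2,
    fun z h₁ h₂ => hβw z ((le_max_left _ _).trans_lt h₁) h₂⟩

end Semantics

/-! ### Loops -/

/-- `σ` is a sequence of mosaics satisfying `Q` that leads from `A` back to `A`, composes to
`(A, B, A)`, and contains every witness that this requires: each formula whose negation is not in
`B` occurs inside `σ`, and so do cures for those Untils and Sinces in `A` whose second argument is
not in `B`. -/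
structure IsLoop (φ : Formula Atom) (Q : Triple Atom → Prop) (B A : Set (Formula Atom))
    (σ : List (Triple Atom)) : Prop where
  cover : IsCover φ B
  start : IsStart φ B A
  finish : IsFinish φ B A
  subset : B ⊆ A
  mosaic : ∀ x ∈ σ, IsMosaic φ x
  mem : ∀ x ∈ σ, Q x
  composes : ComposesTo σ ⟨A, B, A⟩
  untl : ∀ α β, untl α β ∈ A → β ∈ B ∨
    ∃ (i : ℕ) (hi : i + 1 < σ.length), α ∈ σ[i].finish ∧
      (∀ (j : ℕ) (hj : j ≤ i), β ∈ σ[j].cover) ∧ (∀ (j : ℕ) (hj : j < i), β ∈ σ[j].finish)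
  snce : ∀ α β, Formula.snce α β ∈ A → β ∈ B ∨
    ∃ (i : ℕ) (_ : 0 < i) (hi : i < σ.length), α ∈ σ[i].start ∧
      (∀ (j : ℕ) (_ : i ≤ j) (hj : j < σ.length), β ∈ σ[j].cover) ∧
      (∀ (j : ℕ) (_ : i < j) (hj : j < σ.length), β ∈ σ[j].start)
  occurs : ∀ β ∈ φ.closure, sim β ∉ B →
    ∃ (i : ℕ) (hi : i + 1 < σ.length), β ∈ σ[i].finish

section

variable {φ : Formula Atom} {Q : Triple Atom → Prop} {A B : Set (Formula Atom)}
  {σ : List (Triple Atom)}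

/-- From a loop at `A` every end that demands nothing of the cover is reached by a trail along the
loop. -/
theorem IsLoop.trail (hσ : IsLoop φ Q B A σ) {C : Set (Formula Atom)} (hC : IsFinish φ B C)
    (hcov : SnceCovered B C) : LeadTrailComposed φ Q ⟨A, B, C⟩ := by
  have hm : IsMosaic φ ⟨A, B, C⟩ := isMosaic_of_isStart_isFinish hσ.cover hσ.start hC
  have hcomp : ComposesTo (σ ++ [⟨A, B, C⟩]) ⟨A, B, C⟩ := by
    have := hσ.composes.append (.single ⟨A, B, C⟩) rfl
    rwa [Set.inter_right_comm, Set.inter_self, Set.inter_eq_left.2 hσ.subset] at this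
  refine ⟨_, isDecomposition_singleton hm, fun x hx => Or.inr ⟨σ, hσ.mem, Or.inr ?_⟩⟩
  rw [List.mem_singleton.1 hx]
  refine ⟨hσ.composes.ne_nil, isFullDecomposition_of_occurs hm ?_ hcomp ?_ ?_ ?_⟩
  · intro x hx
    rcases List.mem_append.1 hx with hx | hx
    · exact hσ.mosaic x hx
    · rwa [List.mem_singleton.1 hx]
  · intro α β hU
    refine (hσ.untl α β hU).imp id ?_
    rintro ⟨i, hi, h₁, h₂, h₃⟩
    refine ⟨i, by simp; lia, ?_, fun j hj => ?_, fun j hj => ?_⟩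
    · rwa [List.getElem_append_left (by lia)]
    · rw [List.getElem_append_left (by lia)]
      exact h₂ j hj
    · rw [List.getElem_append_left (by lia)]
      exact h₃ j hj
  · exact fun α β hS => Or.inl (hcov α β hS)
  · intro β hβ hs
    obtain ⟨i, hi, h₁⟩ := hσ.occurs β hβ hs
    refine ⟨i, by simp; lia, ?_⟩
    rwa [List.getElem_append_left (by lia)]

/-- Mirror image of `IsLoop.trail`. -/
theorem IsLoop.lead (hσ : IsLoop φ Q B A σ) {C : Set (Formula Atom)} (hC : IsStart φ B C)
    (hcov : UntlCovered B C) : LeadTrailComposed φ Q ⟨C, B, A⟩ := by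
  have hm : IsMosaic φ ⟨C, B, A⟩ := isMosaic_of_isStart_isFinish hσ.cover hC hσ.finish
  have hcomp : ComposesTo (⟨C, B, A⟩ :: σ) ⟨C, B, A⟩ := by
    have := ComposesTo.cons ⟨C, B, A⟩ _ _ hσ.composes rfl
    rwa [Set.inter_right_comm, Set.inter_self, Set.inter_eq_left.2 hσ.subset] at this
  refine ⟨_, isDecomposition_singleton hm, fun x hx => Or.inr ⟨σ, hσ.mem, Or.inl ?_⟩⟩
  rw [List.mem_singleton.1 hx]
  refine ⟨hσ.composes.ne_nil, isFullDecomposition_of_occurs hm ?_ hcomp ?_ ?_ ?_⟩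
  · intro x hx
    rcases List.mem_cons.1 hx with rfl | hx
    · exact hm
    · exact hσ.mosaic x hx
  · exact fun α β hU => Or.inl (hcov α β hU)
  · intro α β hS
    refine (hσ.snce α β hS).imp id ?_
    rintro ⟨i, hi₀, hi, h₁, h₂, h₃⟩
    refine ⟨i + 1, by lia, by simpa using hi, h₁, fun j hij hj => ?_, fun j hij hj => ?_⟩
    · obtain ⟨k, rfl⟩ : ∃ k, j = k + 1 := ⟨j - 1, by lia⟩
      exact h₂ k (by lia) (by simpa using hj)
    · obtain ⟨k, rfl⟩ : ∃ k, j = k + 1 := ⟨j - 1, by lia⟩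
      exact h₃ k (by lia) (by simpa using hj)
  · intro β hβ hs
    obtain ⟨i, hi, h₁⟩ := hσ.occurs β hβ hs
    exact ⟨i + 1, by simpa using hi, h₁⟩

/-- A loop joins every start to every end, provided that these demand nothing of the cover. -/
theorem IsLoop.lead_trail (hσ : IsLoop φ Q B A σ) {C D : Set (Formula Atom)}
    (hC : IsStart φ B C) (hCcov : UntlCovered B C) (hD : IsFinish φ B D)
    (hDcov : SnceCovered B D) : LeadTrailComposed φ Q ⟨C, B, D⟩ := by
  have hcomp : ComposesTo [(⟨C, B, A⟩ : Triple Atom), ⟨A, B, D⟩] ⟨C, B, D⟩ := by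
    have := ComposesTo.pair (m₁ := ⟨C, B, A⟩) (m₂ := ⟨A, B, D⟩) rfl
    rwa [Set.inter_right_comm, Set.inter_self, Set.inter_eq_left.2 hσ.subset] at this
  refine isCompositional_leadTrailComposed φ Q _ _ hcomp
    (isMosaic_of_isStart_isFinish hσ.cover hC hD) fun x hx => ?_
  simp only [List.mem_cons, List.not_mem_nil, or_false] at hx
  rcases hx with rfl | rfl
  · exact hσ.lead hC hCcov
  · exact hσ.trail hD hDcov

end

/-! ### Loops in a structure -/

/-- A finite subset of an open interval, together with the end points of the interval, can be
enumerated in increasing order. -/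
theorem exists_increasing_enumeration {T : Type*} [LinearOrder T] {a b : T} (hab : a < b)
    (W : Finset T) (hW : ∀ w ∈ W, a < w ∧ w < b) :
    ∃ (n : ℕ) (c : ℕ → T), 0 < n ∧ c 0 = a ∧ c n = b ∧ (∀ i j, i < j → j ≤ n → c i < c j) ∧
      ∀ w ∈ W, ∃ i, 0 < i ∧ i < n ∧ c i = w := by
  classical
  set V : Finset T := insert a (insert b W) with hV
  have ha : a ∈ V := by simp [hV]
  have hb : b ∈ V := by simp [hV]
  have hbounds : ∀ v ∈ V, a ≤ v ∧ v ≤ b := by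
    intro v hv
    simp only [hV, Finset.mem_insert] at hv
    rcases hv with rfl | rfl | hv
    · exact ⟨le_rfl, hab.le⟩
    · exact ⟨hab.le, le_rfl⟩
    · exact ⟨(hW v hv).1.le, (hW v hv).2.le⟩
  have hex : ∀ v ∈ V, ∃ i : Fin V.card, V.orderEmbOfFin rfl i = v := by
    intro v hv
    have : v ∈ Set.range (V.orderEmbOfFin rfl) := by simpa using hv
    exact this
  obtain ⟨ia, hia⟩ := hex a ha
  have hpos : 0 < V.card := ia.pos
  have h0 : V.orderEmbOfFin rfl ⟨0, hpos⟩ = a := by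
    refine le_antisymm ?_ (hbounds _ (Finset.orderEmbOfFin_mem _ _ _)).1
    exact ((V.orderEmbOfFin rfl).monotone (Fin.mk_le_of_le_val (Nat.zero_le _))).trans hia.le
  have hn : V.orderEmbOfFin rfl ⟨V.card - 1, by lia⟩ = b := by
    obtain ⟨ib, hib⟩ := hex b hb
    refine le_antisymm (hbounds _ (Finset.orderEmbOfFin_mem _ _ _)).2 ?_
    exact hib.symm.le.trans ((V.orderEmbOfFin rfl).monotone (Fin.le_def.2 (by simp; lia)))
  let c : ℕ → T := fun i => if hi : i < V.card then V.orderEmbOfFin rfl ⟨i, hi⟩ else a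
  have hc : ∀ (i : ℕ) (hi : i < V.card), c i = V.orderEmbOfFin rfl ⟨i, hi⟩ :=
    fun i hi => dif_pos hi
  have hmono : ∀ i j, i < j → j ≤ V.card - 1 → c i < c j := by
    intro i j hij hj
    rw [hc i (by lia), hc j (by lia)]
    exact (V.orderEmbOfFin rfl).strictMono (Fin.lt_def.2 hij)
  have hc0 : c 0 = a := (hc 0 hpos).trans h0
  have hcn : c (V.card - 1) = b := (hc _ (by lia)).trans hn
  refine ⟨V.card - 1, c, Nat.pos_of_ne_zero fun h => ?_, hc0, hcn, hmono, fun w hw => ?_⟩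
  · rw [h, hc0] at hcn
    exact hab.ne hcn
  · obtain ⟨i, hi⟩ := hex w (by simp [hV, hw])
    have hiw : c i = w := (hc i i.2).trans hi
    refine ⟨i, Nat.pos_of_ne_zero fun h => ?_, lt_of_le_of_ne (by lia) fun h => ?_, hiw⟩
    · rw [h, hc0] at hiw
      exact (hW w hw).1.ne hiw
    · rw [h, hcn] at hiw
      exact (hW w hw).2.ne' hiw

section

variable {T : Type*} [LinearOrder T] {h : Atom → Set T} {φ : Formula Atom}

theorem composesTo_map_mos (c : ℕ → T) (k i : ℕ)
    (hc : ∀ j, i ≤ j → j < i + (k + 1) → c j < c (j + 1)) :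
    ComposesTo ((List.range' i (k + 1)).map fun j => mos h φ (c j) (c (j + 1)))
      (mos h φ (c i) (c (i + (k + 1)))) := by
  induction k generalizing i with
  | zero => exact .single _
  | succ k ih =>
    have hlt : c (i + 1) < c (i + 1 + (k + 1)) := by
      have hmono : ∀ n ≤ k, c (i + 1) < c (i + 1 + (n + 1)) := by
        intro n hn
        induction n with
        | zero => exact hc (i + 1) (by lia) (by lia)
        | succ n ihn => exact (ihn (by lia)).trans (hc (i + 1 + (n + 1)) (by lia) (by lia))
      exact hmono k le_rfl
    have hih := ih (i + 1) fun j h₁ h₂ => hc j (by lia) (by lia)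
    have := ComposesTo.cons (mos h φ (c i) (c (i + 1))) _ _ hih rfl
    rw [List.range'_succ, List.map_cons, show i + (k + 1 + 1) = i + 1 + (k + 1) by lia,
      mos_eq h φ (c i) (c (i + 1 + (k + 1))), intervalTruth_eq_inter (hc i le_rfl (by lia)) hlt]
    exact this

theorem exists_not_sat_of_notMem_intervalTruth {β : Formula Atom} (hβ : β ∈ φ.closure) {a b : T}
    (hn : β ∉ intervalTruth h φ a b) : ∃ z, a < z ∧ z < b ∧ ¬ β.Sat h z := by
  by_contra! hcon
  exact hn ⟨hβ, hcon⟩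

theorem exists_sat_of_sim_notMem_intervalTruth {a b : T} {β : Formula Atom}
    (hβ : β ∈ φ.closure) (hn : sim β ∉ intervalTruth h φ a b) :
    ∃ z, a < z ∧ z < b ∧ β.Sat h z := by
  by_contra! hcon
  refine hn ⟨?_, fun z h₁ h₂ => (sat_sim_iff β z).2 (hcon z h₁ h₂)⟩
  cases β with
  | neg γ => exact mem_closure_of_isSubformula (isSubformula_of_neg_mem_closure hβ)
  | _ =>
    refine neg_mem_closure_of_isSubformula (hβ.resolve_right ?_)
    rintro ⟨_, _, he⟩
    cases he

theorem exists_finset_of_witnesses {ι T : Type*} {F : Set ι} (hF : F.Finite) (p : ι → T → Prop) :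
    ∃ W : Finset T, (∀ w ∈ W, ∃ i, p i w) ∧ ∀ i ∈ F, (∃ z, p i z) → ∃ z ∈ W, p i z := by
  classical
  induction F, hF using Set.Finite.induction_on with
  | empty => exact ⟨∅, by simp, by simp⟩
  | @insert i F _ _ ih =>
    obtain ⟨W, h₁, h₂⟩ := ih
    by_cases hi : ∃ z, p i z
    · obtain ⟨z, hz⟩ := hi
      refine ⟨insert z W, ?_, ?_⟩
      · intro w hw
        rcases Finset.mem_insert.1 hw with rfl | hw
        · exact ⟨i, hz⟩
        · exact h₁ w hw
      · rintro j (rfl | hj) hz'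
        · exact ⟨z, by simp, hz⟩
        · obtain ⟨w, hw, hpw⟩ := h₂ j hj hz'
          exact ⟨w, by simp [hw], hpw⟩
    · refine ⟨W, h₁, ?_⟩
      rintro j (rfl | hj) hz'
      · exact absurd hz' hi
      · exact h₂ j hj hz'

/-- Two points at which the same formulas are true give a loop, provided that all mosaics between
them satisfy `Q`: subdivide the interval at enough witnesses. -/
theorem exists_isLoop [DenselyOrdered T] {Q : Triple Atom → Prop} {a b : T} (hab : a < b)
    (htruth : truth h φ a = truth h φ b) (hsub : intervalTruth h φ a b ⊆ truth h φ a)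
    (hQ : ∀ u v, a ≤ u → u < v → v ≤ b → Q (mos h φ u v)) :
    ∃ σ, IsLoop φ Q (intervalTruth h φ a b) (truth h φ a) σ := by
  classical
  set B := intervalTruth h φ a b with hB
  have hF := closure_finite φ
  -- `W₁` holds occurrences of the formulas whose negations are not in `B`, `W₂` cures for the
  -- Untils at `a`, and `W₃` cures for the Sinces at `b`. If the second argument of an Until at `a`
  -- is not in `B`, it fails somewhere in `(a, b)`, so that the cure lies in `(a, b)` too.
  obtain ⟨W₁, hI₁, hW₁⟩ := exists_finset_of_witnesses (T := T) hF
    fun β z => (a < z ∧ z < b) ∧ β.Sat h z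
  obtain ⟨W₂, hI₂, hW₂⟩ := exists_finset_of_witnesses (T := T) (hF.prod hF)
    fun q z => (a < z ∧ z < b) ∧ q.1.Sat h z ∧ ∀ v, a < v → v < z → q.2.Sat h v
  obtain ⟨W₃, hI₃, hW₃⟩ := exists_finset_of_witnesses (T := T) (hF.prod hF)
    fun q z => (a < z ∧ z < b) ∧ q.1.Sat h z ∧ ∀ v, z < v → v < b → q.2.Sat h v
  obtain ⟨n, c, hn, hc0, hcn, hc, hcW⟩ :=
    exists_increasing_enumeration hab (W₁ ∪ W₂ ∪ W₃) fun w hw => by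
      rcases Finset.mem_union.1 hw with hw | hw
      · rcases Finset.mem_union.1 hw with hw | hw
        · obtain ⟨_, hi, -⟩ := hI₁ w hw
          exact hi
        · obtain ⟨_, hi, -⟩ := hI₂ w hw
          exact hi
      · obtain ⟨_, hi, -⟩ := hI₃ w hw
        exact hi
  have hle : ∀ i j, i ≤ j → j ≤ n → c i ≤ c j := by
    intro i j hij hj
    rcases hij.eq_or_lt with rfl | hij
    · exact le_rfl
    · exact (hc i j hij hj).le
  obtain ⟨k, rfl⟩ : ∃ k, n = k + 1 := ⟨n - 1, by lia⟩
  have hcomp := composesTo_map_mos (h := h) (φ := φ) c k 0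
    fun j _ hj => hc j (j + 1) j.lt_succ_self (by lia)
  rw [Nat.zero_add, hc0, hcn, mos_eq, ← htruth] at hcomp
  set σ := (List.range' 0 (k + 1)).map fun j => mos h φ (c j) (c (j + 1)) with hσ
  have hlen : σ.length = k + 1 := by simp [hσ]
  have hget : ∀ (i : ℕ) (hi : i < σ.length), σ[i] = mos h φ (c i) (c (i + 1)) := by
    intro i hi
    simp [hσ]
  have hmem : ∀ x ∈ σ, ∃ i, i < k + 1 ∧ x = mos h φ (c i) (c (i + 1)) := by
    intro x hx
    obtain ⟨i, hi, rfl⟩ := List.getElem_of_mem hx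
    exact ⟨i, hlen ▸ hi, hget i hi⟩
  refine ⟨σ, isCover_intervalTruth a b, isStart_truth hab, htruth ▸ isFinish_truth hab, hsub,
    ?_, ?_, hcomp, ?_, ?_, ?_⟩
  · intro x hx
    obtain ⟨i, hi, rfl⟩ := hmem x hx
    exact isMosaic_mos (hc i (i + 1) i.lt_succ_self (by lia))
  · intro x hx
    obtain ⟨i, hi, rfl⟩ := hmem x hx
    exact hQ _ _ (hc0 ▸ hle 0 i (by lia) (by lia)) (hc i (i + 1) i.lt_succ_self (by lia))
      (hcn ▸ hle (i + 1) (k + 1) (by lia) le_rfl)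
  · rintro α β ⟨hcl, w, haw, hαw, hβw⟩
    refine or_iff_not_imp_left.2 fun hβ => ?_
    have hs := isSubformula_of_untl (isSubformula_untl_of_mem hcl)
    have hα' := mem_closure_of_isSubformula hs.1
    have hβ' := mem_closure_of_isSubformula hs.2
    obtain ⟨v, hv₁, hv₂, hv₃⟩ := exists_not_sat_of_notMem_intervalTruth hβ' hβ
    have hwv : w ≤ v := not_lt.1 fun hvw => hv₃ (hβw v hv₁ hvw)
    obtain ⟨z, hz, -, hαz, hβz⟩ := hW₂ (α, β) ⟨hα', hβ'⟩
      ⟨w, ⟨haw, hwv.trans_lt hv₂⟩, hαw, hβw⟩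
    obtain ⟨i, hi₀, hi, rfl⟩ := hcW z (by simp [hz])
    obtain ⟨i, rfl⟩ : ∃ j, i = j + 1 := ⟨i - 1, by lia⟩
    refine ⟨i, by lia, ?_, fun j hj => ?_, fun j hj => ?_⟩
    · rw [hget]
      exact ⟨hα', hαz⟩
    · rw [hget]
      exact ⟨hβ', fun v h₁ h₂ => hβz v (hc0 ▸ (hle 0 j (by lia) (by lia)).trans_lt h₁)
        (h₂.trans_le (hle _ _ (by lia) (by lia)))⟩
    · rw [hget]
      exact ⟨hβ', hβz _ (hc0 ▸ hc 0 (j + 1) (by lia) (by lia)) (hc _ _ (by lia) (by lia))⟩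
  · intro α β hS
    rw [htruth] at hS
    obtain ⟨hcl, w, hwb, hαw, hβw⟩ := hS
    refine or_iff_not_imp_left.2 fun hβ => ?_
    have hs := isSubformula_of_snce (isSubformula_snce_of_mem hcl)
    have hα' := mem_closure_of_isSubformula hs.1
    have hβ' := mem_closure_of_isSubformula hs.2
    obtain ⟨v, hv₁, hv₂, hv₃⟩ := exists_not_sat_of_notMem_intervalTruth hβ' hβ
    have hvw : v ≤ w := not_lt.1 fun hwv => hv₃ (hβw v hwv hv₂)
    obtain ⟨z, hz, -, hαz, hβz⟩ := hW₃ (α, β) ⟨hα', hβ'⟩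
      ⟨w, ⟨hv₁.trans_le hvw, hwb⟩, hαw, hβw⟩
    obtain ⟨i, hi₀, hi, rfl⟩ := hcW z (by simp [hz])
    refine ⟨i, hi₀, by lia, ?_, fun j hij hj => ?_, fun j hij hj => ?_⟩
    · rw [hget]
      exact ⟨hα', hαz⟩
    · rw [hget]
      exact ⟨hβ', fun v h₁ h₂ => hβz v ((hle _ _ (by lia) (by lia)).trans_lt h₁)
        (hcn ▸ h₂.trans_le (hle _ _ (by lia) (by lia)))⟩
    · rw [hget]
      exact ⟨hβ', hβz _ (hc _ _ (by lia) (by lia)) (hcn ▸ hc j (k + 1) (by lia) le_rfl)⟩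
  · intro β hβ hs
    obtain ⟨z, hz₁, hz₂, hβz⟩ := exists_sat_of_sim_notMem_intervalTruth hβ hs
    obtain ⟨z, hz, -, hβz⟩ := hW₁ β hβ ⟨z, ⟨hz₁, hz₂⟩, hβz⟩
    obtain ⟨i, hi₀, hi, rfl⟩ := hcW z (by simp [hz])
    obtain ⟨i, rfl⟩ : ∃ j, i = j + 1 := ⟨i - 1, by lia⟩
    refine ⟨i, by lia, ?_⟩
    rw [hget]
    exact ⟨hβ, hβz⟩

end

/-! ### Limits of intervals -/

section

variable {T : Type*} [LinearOrder T]

/-- A map to a finite type takes some value at points arbitrarily close to `d` on the left. -/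
theorem exists_recurrent_left [DenselyOrdered T] {τ : Type*} [Finite τ] (f : T → τ) {u d : T}
    (hud : u < d) : ∃ A, ∀ t < d, ∃ v, u < v ∧ t < v ∧ v < d ∧ f v = A := by
  by_contra! hcon
  choose t ht hf using hcon
  obtain ⟨W, hW₁, hW₂⟩ := exists_finset_of_witnesses (Set.finite_univ (α := τ))
    fun A z => z = t A
  let M := (insert u W).max' (Finset.insert_nonempty _ _)
  have hM : ∀ z ∈ insert u W, z ≤ M := fun z hz => Finset.le_max' _ z hz
  have hMd : M < d := by
    rcases Finset.mem_insert.1 (Finset.max'_mem (insert u W) (Finset.insert_nonempty _ _)) with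
      h | h
    · exact h.trans_lt hud
    · obtain ⟨A, hA⟩ := hW₁ _ h
      exact hA.trans_lt (ht A)
  obtain ⟨v, hMv, hvd⟩ := exists_between hMd
  obtain ⟨z, hz, hzt⟩ := hW₂ (f v) trivial ⟨_, rfl⟩
  subst hzt
  exact hf (f v) v ((hM u (by simp)).trans_lt hMv) ((hM _ (by simp [hz])).trans_lt hMv) hvd rfl

theorem exists_recurrent_right [DenselyOrdered T] {τ : Type*} [Finite τ] (f : T → τ) {d u : T}
    (hdu : d < u) : ∃ A, ∀ t, d < t → ∃ v, v < u ∧ v < t ∧ d < v ∧ f v = A :=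
  exists_recurrent_left (T := Tᵒᵈ) (fun v => f (OrderDual.ofDual v)) hdu

variable {h : Atom → Set T} {φ : Formula Atom} {Q : Triple Atom → Prop}

theorem exists_recurrent_truth_left [DenselyOrdered T] {u d : T} (hud : u < d) :
    ∃ A, ∀ t < d, ∃ v, u < v ∧ t < v ∧ v < d ∧ truth h φ v = A := by
  have : Finite {X : Set (Formula Atom) // X ⊆ φ.closure} := (closure_finite φ).finite_subsets
  obtain ⟨A, hA⟩ := exists_recurrent_left
    (fun v => (⟨truth h φ v, fun _ hα => hα.1⟩ : {X // X ⊆ φ.closure})) hud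
  refine ⟨A, fun t ht => ?_⟩
  obtain ⟨v, h₁, h₂, h₃, h₄⟩ := hA t ht
  exact ⟨v, h₁, h₂, h₃, congrArg Subtype.val h₄⟩

theorem exists_recurrent_truth_right [DenselyOrdered T] {d u : T} (hdu : d < u) :
    ∃ A, ∀ t, d < t → ∃ v, v < u ∧ v < t ∧ d < v ∧ truth h φ v = A := by
  have : Finite {X : Set (Formula Atom) // X ⊆ φ.closure} := (closure_finite φ).finite_subsets
  obtain ⟨A, hA⟩ := exists_recurrent_right
    (fun v => (⟨truth h φ v, fun _ hα => hα.1⟩ : {X // X ⊆ φ.closure})) hdu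
  refine ⟨A, fun t ht => ?_⟩
  obtain ⟨v, h₁, h₂, h₃, h₄⟩ := hA t ht
  exact ⟨v, h₁, h₂, h₃, congrArg Subtype.val h₄⟩

/-- The set of formulas true throughout `(a, b)` does not change any more once `b < d` is close
to `d`. -/
theorem exists_intervalTruth_eq_of_lt {a d : T} (had : a < d) :
    ∃ t < d, ∀ b, t < b → b < d → intervalTruth h φ a b = intervalTruth h φ a d := by
  obtain ⟨W, hW₁, hW₂⟩ := exists_finset_of_witnesses (T := T) (closure_finite φ)
    fun β z => a < z ∧ z < d ∧ ¬ β.Sat h z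
  refine ⟨(insert a W).max' (Finset.insert_nonempty _ _), ?_, fun b hb hbd => ?_⟩
  · rcases Finset.mem_insert.1 (Finset.max'_mem (insert a W) (Finset.insert_nonempty _ _)) with
      h | h
    · exact h.trans_lt had
    · obtain ⟨β, hβ⟩ := hW₁ _ h
      exact hβ.2.1
  · refine (Set.Subset.antisymm (intervalTruth_anti le_rfl hbd.le) fun β hβ => ?_).symm
    by_contra hn
    obtain ⟨z, hz, haz, -, hzβ⟩ :=
      hW₂ β hβ.1 (exists_not_sat_of_notMem_intervalTruth hβ.1 hn)
    exact hzβ (hβ.2 z haz ((Finset.le_max' _ z (by simp [hz])).trans_lt hb))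

theorem exists_intervalTruth_eq_of_gt {d b : T} (hdb : d < b) :
    ∃ t, d < t ∧ ∀ a, d < a → a < t → intervalTruth h φ a b = intervalTruth h φ d b := by
  obtain ⟨W, hW₁, hW₂⟩ := exists_finset_of_witnesses (T := T) (closure_finite φ)
    fun β z => d < z ∧ z < b ∧ ¬ β.Sat h z
  refine ⟨(insert b W).min' (Finset.insert_nonempty _ _), ?_, fun a hda ha => ?_⟩
  · rcases Finset.mem_insert.1 (Finset.min'_mem (insert b W) (Finset.insert_nonempty _ _)) with
      h | h
    · exact hdb.trans_le h.ge
    · obtain ⟨β, hβ⟩ := hW₁ _ h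
      exact hβ.1
  · refine (Set.Subset.antisymm (intervalTruth_anti hda.le le_rfl) fun β hβ => ?_).symm
    by_contra hn
    obtain ⟨z, hz, -, hzb, hzβ⟩ :=
      hW₂ β hβ.1 (exists_not_sat_of_notMem_intervalTruth hβ.1 hn)
    exact hzβ (hβ.2 z (ha.trans_le (Finset.min'_le _ z (by simp [hz]))) hzb)

/-- All mosaics of the structure between points of `[u, v]` satisfy `Q`. -/
def AllMos (h : Atom → Set T) (φ : Formula Atom) (Q : Triple Atom → Prop) (u v : T) : Prop :=
  ∀ a b, u ≤ a → a < b → b ≤ v → Q (mos h φ a b)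

theorem AllMos.anti {u u' v v' : T} (H : AllMos h φ Q u v) (hu : u ≤ u') (hv : v' ≤ v) :
    AllMos h φ Q u' v' :=
  fun a b h₁ h₂ h₃ => H a b (hu.trans h₁) h₂ (h₃.trans hv)

theorem AllMos.mono {Q' : Triple Atom → Prop} {u v : T} (H : AllMos h φ Q u v)
    (hQ : ∀ a b, a < b → Q (mos h φ a b) → Q' (mos h φ a b)) : AllMos h φ Q' u v :=
  fun a b h₁ h₂ h₃ => hQ a b h₂ (H a b h₁ h₂ h₃)

theorem allMos_self (u : T) : AllMos h φ Q u u :=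
  fun _ _ h₁ h₂ h₃ => absurd (h₁.trans_lt h₂) h₃.not_gt

theorem IsCompositional.mos [DenselyOrdered T] (hQ : IsCompositional φ Q) {a b c : T}
    (hab : a < b) (hbc : b < c) (h₁ : Q (mos h φ a b)) (h₂ : Q (mos h φ b c)) :
    Q (mos h φ a c) := by
  refine hQ _ _ (composesTo_mos_pair hab hbc) (isMosaic_mos (hab.trans hbc)) fun x hx => ?_
  simp only [List.mem_cons, List.not_mem_nil, or_false] at hx
  rcases hx with rfl | rfl
  · exact h₁
  · exact h₂

theorem AllMos.trans [DenselyOrdered T] (hQ : IsCompositional φ Q) {u v w : T}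
    (h₁ : AllMos h φ Q u v) (h₂ : AllMos h φ Q v w) : AllMos h φ Q u w := by
  intro a b hua hab hbw
  rcases le_or_gt b v with hbv | hvb
  · exact h₁ a b hua hab hbv
  rcases le_or_gt v a with hva | hav
  · exact h₂ a b hva hab hbw
  · exact hQ.mos hav hvb (h₁ a v hua hav le_rfl) (h₂ v b le_rfl hvb hbw)

/-- If the mosaics below `d` satisfy `Q` and those ending in `d` have cover `B`, then some set of
formulas is true at points arbitrarily close to `d`, and two such points give a loop. -/
theorem exists_isLoop_left [DenselyOrdered T] {B : Set (Formula Atom)} {u d : T} (hud : u < d)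
    (hB : ∀ v, u ≤ v → v < d → intervalTruth h φ v d = B)
    (hQ : ∀ v, u ≤ v → v < d → AllMos h φ Q u v) :
    ∃ a σ, u < a ∧ a < d ∧ IsLoop φ Q B (truth h φ a) σ := by
  obtain ⟨A, hA⟩ := exists_recurrent_truth_left (h := h) (φ := φ) hud
  obtain ⟨a, hua, -, had, haA⟩ := hA u hud
  obtain ⟨t, htd, ht⟩ := exists_intervalTruth_eq_of_lt (h := h) (φ := φ) had
  -- Beyond `t` the cover between `a` and the second point of the loop is `B`.
  obtain ⟨b, -, hb, hbd, hbA⟩ := hA (max a t) (max_lt had htd)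
  have hab := (le_max_left _ _).trans_lt hb
  have hcov : intervalTruth h φ a b = B :=
    (ht b ((le_max_right _ _).trans_lt hb) hbd).trans (hB a hua.le had)
  have hsub : B ⊆ truth h φ a := hB u le_rfl hud ▸ intervalTruth_subset_truth hua had
  obtain ⟨σ, hσ⟩ := exists_isLoop hab (haA.trans hbA.symm) (hcov ▸ hsub)
    ((hQ b (hua.le.trans hab.le) hbd).anti hua.le le_rfl)
  exact ⟨a, σ, hua, had, hcov ▸ hσ⟩

/-- Mirror image of `exists_isLoop_left`. -/
theorem exists_isLoop_right [DenselyOrdered T] {B : Set (Formula Atom)} {d u : T} (hdu : d < u)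
    (hB : ∀ v, d < v → v ≤ u → intervalTruth h φ d v = B)
    (hQ : ∀ v, d < v → v ≤ u → AllMos h φ Q v u) :
    ∃ b σ, d < b ∧ b < u ∧ IsLoop φ Q B (truth h φ b) σ := by
  obtain ⟨A, hA⟩ := exists_recurrent_truth_right (h := h) (φ := φ) hdu
  obtain ⟨b, hbu, -, hdb, hbA⟩ := hA u hdu
  obtain ⟨t, hdt, ht⟩ := exists_intervalTruth_eq_of_gt (h := h) (φ := φ) hdb
  obtain ⟨a, -, ha, hda, haA⟩ := hA (min b t) (lt_min hdb hdt)
  have hab := ha.trans_le (min_le_left _ _)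
  have hcov : intervalTruth h φ a b = B :=
    (ht a hda (ha.trans_le (min_le_right _ _))).trans (hB b hdb hbu.le)
  have htr := haA.trans hbA.symm
  have hsub : B ⊆ truth h φ a := htr ▸ hB u hdu le_rfl ▸ intervalTruth_subset_truth hdb hbu
  obtain ⟨σ, hσ⟩ := exists_isLoop hab htr (hcov ▸ hsub)
    ((hQ a hda (hab.le.trans hbu.le)).anti le_rfl hbu.le)
  exact ⟨b, σ, hdb, hbu, htr ▸ hcov ▸ hσ⟩

end

/-! ### Shuffles -/

/-- The sequence leads from the first set to the last one, each of its mosaics beginning where the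
previous one ends, and all covers and all intermediate sets contain `B`. -/
inductive Path (B : Set (Formula Atom)) :
    Set (Formula Atom) → List (Triple Atom) → Set (Formula Atom) → Prop
  | nil (A : Set (Formula Atom)) : Path B A [] A
  | cons (m : Triple Atom) (l : List (Triple Atom)) (C : Set (Formula Atom)) :
      B ⊆ m.cover → (l = [] ∨ B ⊆ m.finish) → Path B m.finish l C → Path B m.start (m :: l) C

namespace Path

variable {φ : Formula Atom} {B A C D : Set (Formula Atom)} {l l₁ l₂ : List (Triple Atom)}

theorem single {m : Triple Atom} (h : B ⊆ m.cover) : Path B m.start [m] m.finish :=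
  .cons _ _ _ h (Or.inl rfl) (.nil _)

theorem eq_of_nil (h : Path B A [] C) : A = C := by
  cases h
  rfl

theorem append (h₁ : Path B A l₁ D) (h₂ : Path B D l₂ C) (hD : B ⊆ D) :
    Path B A (l₁ ++ l₂) C := by
  induction h₁ with
  | nil A => exact h₂
  | cons m l D hc hf hl ih =>
    refine .cons _ _ _ hc (Or.inr ?_) (ih h₂ hD)
    rcases hf with rfl | hf
    · exact hl.eq_of_nil ▸ hD
    · exact hf

theorem composesTo (h : Path B A l C) (hl : l ≠ []) :
    ∃ E, B ⊆ E ∧ ComposesTo l ⟨A, E, C⟩ := by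
  induction h with
  | nil A => exact absurd rfl hl
  | cons m l C hc hf h ih =>
    rcases eq_or_ne l [] with rfl | hne
    · obtain rfl := h.eq_of_nil
      exact ⟨m.cover, hc, .single m⟩
    · obtain ⟨E, hE, hcomp⟩ := ih hne
      exact ⟨_, Set.subset_inter (Set.subset_inter hc (hf.resolve_left hne)) hE,
        .cons m _ l hcomp rfl⟩

theorem composesTo_of_cover_eq {m : Triple Atom} (h : Path B A (m :: l) C) (hm : m.cover = B) :
    ComposesTo (m :: l) ⟨A, B, C⟩ := by
  obtain ⟨E, hE, hcomp⟩ := h.composesTo (by simp)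
  rwa [hE.antisymm (hm ▸ hcomp.cover_subset m (by simp))]

theorem _root_.RTL.ComposesTo.path {m : Triple Atom} (h : ComposesTo l m) (hB : B ⊆ m.cover) :
    Path B m.start l m.finish := by
  induction h with
  | single m => exact single hB
  | cons m m' l hl he ih =>
    refine .cons _ _ _ (fun a ha => (hB ha).1.1) (Or.inr fun a ha => (hB ha).1.2) ?_
    exact he ▸ ih fun a ha => (hB ha).2

/-- A path from `A` to `C` with a first cover equal to `B` fully decomposes `(A, B, C)`, provided
that `A` and `C` demand nothing of `B`, and all formulas whose negations are not in `B` occur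
after the first mosaic. -/
theorem isFullDecomposition {m : Triple Atom} (h : Path B A (m :: l) C) (hm : m.cover = B)
    (hmos : ∀ x ∈ m :: l, IsMosaic φ x) (hB : IsCover φ B) (hA : IsStart φ B A)
    (hAcov : UntlCovered B A) (hC : IsFinish φ B C) (hCcov : SnceCovered B C)
    (hW : ∀ β ∈ φ.closure, sim β ∉ B → ∃ x ∈ l, β ∈ x.start) :
    IsFullDecomposition φ (m :: l) ⟨A, B, C⟩ := by
  have hcomp := h.composesTo_of_cover_eq hm
  refine isFullDecomposition_of_occurs (isMosaic_of_isStart_isFinish hB hA hC) hmos hcomp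
    (fun α β hU => Or.inl (hAcov α β hU)) (fun α β hS => Or.inl (hCcov α β hS)) fun β hβ hs => ?_
  obtain ⟨x, hx, hβx⟩ := hW β hβ hs
  obtain ⟨i, hi, rfl⟩ := List.getElem_of_mem hx
  have hi' : i + 1 < (m :: l).length := by simpa using hi
  exact ⟨i, hi', hcomp.finish_eq_start i hi' ▸ hβx⟩

end Path

/-- `A` may stand at both ends of mosaics with cover `B`, demands nothing of `B` and may be an
intermediate set in a composition with cover `B`: the formulas true at a point at which `B` is the
limit cover from both sides. -/
structure IsShufflePoint (φ : Formula Atom) (B A : Set (Formula Atom)) : Prop where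
  start : IsStart φ B A
  untlCovered : UntlCovered B A
  finish : IsFinish φ B A
  snceCovered : SnceCovered B A
  subset : B ⊆ A

/-- The analogue of `IsShufflePoint` for a sequence of mosaics, which replaces the point. -/
structure IsShuffleBlock (φ : Formula Atom) (B : Set (Formula Atom)) (l : List (Triple Atom)) :
    Prop where
  ne_nil : l ≠ []
  mosaic : ∀ x ∈ l, IsMosaic φ x
  path : Path B (seqStart l) l (seqStop l)
  start : IsStart φ B (seqStop l)
  untlCovered : UntlCovered B (seqStop l)
  finish : IsFinish φ B (seqStart l)
  snceCovered : SnceCovered B (seqStart l)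
  subset_start : B ⊆ seqStart l
  subset_stop : B ⊆ seqStop l

namespace ShuffleData

variable (D : ShuffleData Atom) (B : Set (Formula Atom))

theorem mem_ySeq {i j : ℕ} {t : Triple Atom} :
    t ∈ D.ySeq B i j ↔ ∃ k, i ≤ k ∧ k ≤ j ∧ t = D.y B k := by
  simp only [ySeq, List.mem_map, List.mem_range'_1]
  constructor
  · rintro ⟨k, hk, rfl⟩
    exact ⟨k, hk.1, by lia, rfl⟩
  · rintro ⟨k, h₁, h₂, rfl⟩
    exact ⟨k, ⟨h₁, by lia⟩, rfl⟩

theorem mem_blocks {i j : ℕ} {t : Triple Atom} :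
    t ∈ D.blocks B i j ↔ ∃ k, i < k ∧ k ≤ j ∧ (t ∈ D.lam k ∨ t = D.x B k) := by
  simp only [blocks, List.mem_flatMap, List.mem_range'_1, List.mem_append, List.mem_singleton]
  constructor
  · rintro ⟨k, hk, ht⟩
    exact ⟨k, hk.1, by lia, ht⟩
  · rintro ⟨k, h₁, h₂, ht⟩
    exact ⟨k, ⟨h₁, by lia⟩, ht⟩

theorem ySeq_eq_cons {i j : ℕ} (hij : i ≤ j) :
    D.ySeq B i j = D.y B i :: D.ySeq B (i + 1) j := by
  simp only [ySeq]
  rw [show j + 1 - i = (j + 1 - (i + 1)) + 1 by lia, List.range'_succ, List.map_cons]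

theorem blocks_self (i : ℕ) : D.blocks B i i = [] := by
  simp [blocks]

theorem blocks_eq_append {i j : ℕ} (hij : i < j) :
    D.blocks B i j = (D.lam (i + 1) ++ [D.x B (i + 1)]) ++ D.blocks B (i + 1) j := by
  simp only [blocks]
  rw [show j - i = (j - (i + 1)) + 1 by lia, List.range'_succ, List.flatMap_cons]

theorem lamAll_of_pos (hr : 0 < D.r) : D.lamAll B = D.x B 0 :: D.blocks B 0 D.r :=
  if_neg hr.ne'

end ShuffleData

/-- The parameters `D` consist of sets and sequences admissible for a shuffle with cover `B`, and
every formula whose negation is not in `B` occurs in them. -/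
structure IsShuffleFor (φ : Formula Atom) (B : Set (Formula Atom)) (D : ShuffleData Atom) :
    Prop where
  cover : IsCover φ B
  point : ∀ i ≤ D.s, IsShufflePoint φ B (D.P i)
  block : ∀ i, 1 ≤ i → i ≤ D.r → IsShuffleBlock φ B (D.lam i)
  occurs : ∀ β ∈ φ.closure, sim β ∉ B → (∃ i ≤ D.s, β ∈ D.P i) ∨
    ∃ i, 1 ≤ i ∧ i ≤ D.r ∧ ((∃ x ∈ D.lam i, β ∈ x.start) ∨ β ∈ seqStop (D.lam i))

namespace IsShuffleFor

variable {φ : Formula Atom} {B : Set (Formula Atom)} {D : ShuffleData Atom}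

theorem point_y_finish (hD : IsShuffleFor φ B D) {i : ℕ} (hi : i ≤ D.s) :
    IsShufflePoint φ B (D.y B i).finish := by
  simp only [ShuffleData.y]
  split_ifs with h
  · exact hD.point 0 (Nat.zero_le _)
  · exact hD.point (i + 1) (by lia)

theorem y_finish_self : (D.y B D.s).finish = D.P 0 := if_pos rfl

theorem y_finish_of_lt {i : ℕ} (hi : i < D.s) : (D.y B i).finish = D.P (i + 1) := if_neg hi.ne

theorem x_start_zero : (D.x B 0).start = D.P 0 := by
  simp [ShuffleData.x]

theorem x_start_of_pos {i : ℕ} (hi : 0 < i) : (D.x B i).start = seqStop (D.lam i) :=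
  if_neg hi.ne'

theorem x_finish_self : (D.x B D.r).finish = D.P 0 := if_pos (c := D.r = D.r) rfl

theorem x_finish_of_lt {i : ℕ} (hi : i < D.r) :
    (D.x B i).finish = seqStart (D.lam (i + 1)) := if_neg hi.ne

theorem x_start (hD : IsShuffleFor φ B D) {i : ℕ} (hi : i ≤ D.r) :
    IsStart φ B (D.x B i).start ∧ UntlCovered B (D.x B i).start := by
  rcases Nat.eq_zero_or_pos i with rfl | h0
  · rw [x_start_zero]
    exact ⟨(hD.point 0 (Nat.zero_le _)).start, (hD.point 0 (Nat.zero_le _)).untlCovered⟩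
  · rw [x_start_of_pos h0]
    exact ⟨(hD.block i h0 hi).start, (hD.block i h0 hi).untlCovered⟩

theorem x_finish (hD : IsShuffleFor φ B D) {i : ℕ} (hi : i ≤ D.r) :
    IsFinish φ B (D.x B i).finish ∧ SnceCovered B (D.x B i).finish ∧ B ⊆ (D.x B i).finish := by
  rcases hi.eq_or_lt with rfl | hlt
  · rw [x_finish_self]
    have := hD.point 0 (Nat.zero_le _)
    exact ⟨this.finish, this.snceCovered, this.subset⟩
  · rw [x_finish_of_lt hlt]
    have := hD.block (i + 1) (by lia) hlt
    exact ⟨this.finish, this.snceCovered, this.subset_start⟩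

theorem isMosaic_y (hD : IsShuffleFor φ B D) {i : ℕ} (hi : i ≤ D.s) : IsMosaic φ (D.y B i) :=
  isMosaic_of_isStart_isFinish hD.cover (hD.point i hi).start (hD.point_y_finish hi).finish

theorem isMosaic_x (hD : IsShuffleFor φ B D) {i : ℕ} (hi : i ≤ D.r) : IsMosaic φ (D.x B i) :=
  isMosaic_of_isStart_isFinish hD.cover (hD.x_start hi).1 (hD.x_finish hi).1

theorem path_ySeq (hD : IsShuffleFor φ B D) {i j : ℕ} (hij : i ≤ j) (hj : j ≤ D.s) :
    Path B (D.P i) (D.ySeq B i j) (D.y B j).finish := by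
  induction hij using Nat.decreasingInduction with
  | self =>
    rw [D.ySeq_eq_cons B le_rfl, show D.ySeq B (j + 1) j = [] by simp [ShuffleData.ySeq]]
    exact Path.single (m := D.y B j) subset_rfl
  | of_succ i hi ih =>
    rw [D.ySeq_eq_cons B (by lia)]
    have hf := y_finish_of_lt (D := D) (B := B) (i := i) (by lia)
    refine Path.cons (D.y B i) _ _ subset_rfl (Or.inr ?_) ?_
    · exact (hD.point_y_finish (by lia)).subset
    · rw [hf]
      exact ih

theorem path_mu (hD : IsShuffleFor φ B D) : Path B (D.P 0) (D.mu B) (D.P 0) := by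
  have := hD.path_ySeq (Nat.zero_le D.s) le_rfl
  rwa [y_finish_self] at this

theorem path_blocks (hD : IsShuffleFor φ B D) {i j : ℕ} (hij : i ≤ j) (hj : j ≤ D.r) :
    Path B (D.x B i).finish (D.blocks B i j) (D.x B j).finish := by
  induction hij using Nat.decreasingInduction with
  | self =>
    rw [D.blocks_self B]
    exact Path.nil _
  | of_succ i hi ih =>
    have hb := hD.block (i + 1) (by lia) (by lia)
    rw [D.blocks_eq_append B hi, x_finish_of_lt (by lia)]
    refine Path.append (Path.append hb.path ?_ hb.subset_stop) ih (hD.x_finish (by lia)).2.2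
    rw [← x_start_of_pos (B := B) i.succ_pos]
    exact Path.single subset_rfl

theorem path_lamAll (hD : IsShuffleFor φ B D) : Path B (D.P 0) (D.lamAll B) (D.P 0) := by
  rcases Nat.eq_zero_or_pos D.r with hr | hr
  · rw [ShuffleData.lamAll, if_pos hr]
    exact Path.nil _
  · rw [D.lamAll_of_pos B hr]
    have := hD.path_blocks (Nat.zero_le D.r) le_rfl
    rw [x_finish_self] at this
    exact Path.cons (D.x B 0) _ _ subset_rfl (Or.inr (hD.x_finish (Nat.zero_le _)).2.2) this

theorem isMosaic_of_mem_ySeq (hD : IsShuffleFor φ B D) {i j : ℕ} (hj : j ≤ D.s) :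
    ∀ t ∈ D.ySeq B i j, IsMosaic φ t := by
  intro t ht
  obtain ⟨k, -, hk, rfl⟩ := (D.mem_ySeq B).1 ht
  exact hD.isMosaic_y (hk.trans hj)

theorem isMosaic_of_mem_blocks (hD : IsShuffleFor φ B D) {i j : ℕ} (hj : j ≤ D.r) :
    ∀ t ∈ D.blocks B i j, IsMosaic φ t := by
  intro t ht
  obtain ⟨k, hk₁, hk₂, h | rfl⟩ := (D.mem_blocks B).1 ht
  · exact (hD.block k (by lia) (hk₂.trans hj)).mosaic t h
  · exact hD.isMosaic_x (hk₂.trans hj)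

theorem isMosaic_of_mem_lamAll (hD : IsShuffleFor φ B D) : ∀ t ∈ D.lamAll B, IsMosaic φ t := by
  intro t ht
  rcases Nat.eq_zero_or_pos D.r with hr | hr
  · simp [ShuffleData.lamAll, hr] at ht
  · rw [D.lamAll_of_pos B hr] at ht
    rcases List.mem_cons.1 ht with rfl | ht
    · exact hD.isMosaic_x (Nat.zero_le _)
    · exact hD.isMosaic_of_mem_blocks le_rfl t ht

/-- The occurrence condition of a full decomposition, for a sequence that contains all parts of
the shuffle after its first mosaic. -/
theorem exists_mem_start (hD : IsShuffleFor φ B D) {l : List (Triple Atom)}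
    (hy : ∀ i ≤ D.s, D.y B i ∈ l)
    (hx : ∀ i, 1 ≤ i → i ≤ D.r → D.x B i ∈ l ∧ ∀ t ∈ D.lam i, t ∈ l) :
    ∀ β ∈ φ.closure, sim β ∉ B → ∃ t ∈ l, β ∈ t.start := by
  intro β hβ hs
  rcases hD.occurs β hβ hs with ⟨i, hi, hβi⟩ | ⟨i, h₁, h₂, ⟨t, ht, hβt⟩ | hβs⟩
  · exact ⟨_, hy i hi, hβi⟩
  · exact ⟨t, (hx i h₁ h₂).2 t ht, hβt⟩
  · exact ⟨_, (hx i h₁ h₂).1, by rwa [x_start_of_pos h₁]⟩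

theorem y_mem_mu {i : ℕ} (hi : i ≤ D.s) : D.y B i ∈ D.mu B :=
  (D.mem_ySeq B).2 ⟨i, Nat.zero_le _, hi, rfl⟩

theorem x_mem_blocks {i j k : ℕ} (h₁ : j < i) (h₂ : i ≤ k) :
    D.x B i ∈ D.blocks B j k ∧ ∀ t ∈ D.lam i, t ∈ D.blocks B j k :=
  ⟨(D.mem_blocks B).2 ⟨i, h₁, h₂, Or.inr rfl⟩,
    fun _ ht => (D.mem_blocks B).2 ⟨i, h₁, h₂, Or.inl ht⟩⟩

theorem x_mem_lamAll {i : ℕ} (h₁ : 1 ≤ i) (h₂ : i ≤ D.r) :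
    D.x B i ∈ D.lamAll B ∧ ∀ t ∈ D.lam i, t ∈ D.lamAll B := by
  rw [D.lamAll_of_pos B (by lia)]
  have := x_mem_blocks (B := B) (D := D) h₁ h₂
  exact ⟨List.mem_cons_of_mem _ this.1, fun t ht => List.mem_cons_of_mem _ (this.2 t ht)⟩

/-- Every mosaic with cover `B` whose ends demand nothing of `B` is fully decomposed by every
admissible shuffle in which all necessary formulas occur. -/
theorem fullyDecomposedByShuffle (hD : IsShuffleFor φ B D) {A C : Set (Formula Atom)}
    (hA : IsStart φ B A) (hAcov : UntlCovered B A) (hC : IsFinish φ B C)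
    (hCcov : SnceCovered B C) : FullyDecomposedByShuffle φ ⟨A, B, C⟩ D := by
  have hP := hD.point 0 (Nat.zero_le _)
  have hm₁ : IsMosaic φ ⟨A, B, D.P 0⟩ := isMosaic_of_isStart_isFinish hD.cover hA hP.finish
  have hm₂ : IsMosaic φ ⟨D.P 0, B, C⟩ := isMosaic_of_isStart_isFinish hD.cover hP.start hC
  have hmu := hD.path_mu
  have hlam := hD.path_lamAll
  have hMmu : ∀ t ∈ D.mu B, IsMosaic φ t := hD.isMosaic_of_mem_ySeq le_rfl
  have hMlam := hD.isMosaic_of_mem_lamAll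
  refine ⟨isMosaic_of_isStart_isFinish hD.cover hA hC, fun i hi => (hD.point i hi).start.mpc,
    fun i h₁ h₂ => (hD.block i h₁ h₂).mosaic, fun i h₁ h₂ => ?_, hm₁, hm₂,
    fun i hi => hD.isMosaic_y hi, fun _ i hi => hD.isMosaic_x hi, ?_, fun hr => ?_,
    fun i hi₀ hi => ?_, fun hr => ?_, fun i hi => ?_, ?_⟩
  · obtain ⟨E, -, hE⟩ := (hD.block i h₁ h₂).path.composesTo (hD.block i h₁ h₂).ne_nil
    exact ⟨_, hE⟩
  · have hpath : Path B A ([⟨A, B, D.P 0⟩] ++ D.lamAll B ++ D.mu B ++ [⟨D.P 0, B, C⟩]) C :=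
      ((((Path.single (m := ⟨A, B, D.P 0⟩) subset_rfl).append hlam hP.subset).append hmu
        hP.subset).append (Path.single (m := ⟨D.P 0, B, C⟩) subset_rfl) hP.subset)
    simp only [List.append_assoc, List.cons_append, List.nil_append] at hpath ⊢
    refine hpath.isFullDecomposition rfl ?_ hD.cover hA hAcov hC hCcov
      (hD.exists_mem_start (fun i hi => ?_) fun i h₁ h₂ => ?_)
    · intro t ht
      simp only [List.mem_cons, List.mem_append, List.not_mem_nil, or_false] at ht
      rcases ht with rfl | ht | ht | rfl
      exacts [hm₁, hMlam t ht, hMmu t ht, hm₂]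
    · simp [y_mem_mu hi]
    · have := x_mem_lamAll (B := B) h₁ h₂
      exact ⟨by simp [this.1], fun t ht => by simp [this.2 t ht]⟩
  · have h0 := hD.x_start (Nat.zero_le D.r)
    have h1 := hD.x_finish (Nat.zero_le D.r)
    have hpath : Path B (D.x B 0).start (D.lamAll B ++ D.mu B ++ [D.x B 0])
        (D.x B 0).finish := by
      rw [x_start_zero]
      exact (hlam.append hmu hP.subset).append (x_start_zero ▸ Path.single subset_rfl) hP.subset
    rw [D.lamAll_of_pos B hr] at hpath hMlam ⊢
    simp only [List.append_assoc, List.cons_append] at hpath ⊢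
    refine hpath.isFullDecomposition rfl ?_ hD.cover h0.1 h0.2 h1.1 h1.2.1
      (hD.exists_mem_start (fun i hi => ?_) fun i h₁ h₂ => ?_)
    · intro t ht
      simp only [List.mem_cons, List.mem_append, List.not_mem_nil, or_false] at ht
      rcases ht with rfl | ht | ht | rfl
      exacts [hMlam _ (by simp), hMlam t (by simp [ht]), hMmu t ht, hMlam _ (by simp)]
    · simp [y_mem_mu hi]
    · have := x_mem_blocks (B := B) (D := D) h₁ h₂
      exact ⟨by simp [this.1], fun t ht => by simp [this.2 t ht]⟩
  · have h0 := hD.x_start hi.le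
    have h1 := hD.x_finish hi.le
    have hMx : ∀ j ≤ D.r, IsMosaic φ (D.x B j) := fun j hj => hD.isMosaic_x hj
    have hpath : Path B (D.x B i).start ([D.x B i] ++ D.blocks B i D.r ++ D.mu B ++ [D.x B 0] ++
        D.blocks B 0 i) (D.x B i).finish := by
      have hb := hD.path_blocks hi.le le_rfl
      rw [x_finish_self] at hb
      exact (((((Path.single (m := D.x B i) subset_rfl).append hb h1.2.2).append hmu
        hP.subset).append
        (x_start_zero ▸ Path.single (m := D.x B 0) subset_rfl) hP.subset).append
        (hD.path_blocks (Nat.zero_le i) hi.le) (hD.x_finish (Nat.zero_le _)).2.2)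
    simp only [List.append_assoc, List.cons_append, List.nil_append] at hpath ⊢
    refine hpath.isFullDecomposition rfl ?_ hD.cover h0.1 h0.2 h1.1 h1.2.1
      (hD.exists_mem_start (fun j hj => ?_) fun j h₁ h₂ => ?_)
    · intro t ht
      simp only [List.mem_cons, List.mem_append] at ht
      rcases ht with rfl | ht | ht | rfl | ht
      exacts [hMx i hi.le, hD.isMosaic_of_mem_blocks le_rfl t ht, hMmu t ht,
        hMx 0 (Nat.zero_le _), hD.isMosaic_of_mem_blocks hi.le t ht]
    · simp [y_mem_mu hj]
    · rcases le_or_gt j i with hji | hij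
      · have := x_mem_blocks (B := B) (D := D) h₁ hji
        exact ⟨by simp [this.1], fun t ht => by simp [this.2 t ht]⟩
      · have := x_mem_blocks (B := B) (D := D) hij h₂
        exact ⟨by simp [this.1], fun t ht => by simp [this.2 t ht]⟩
  · have h0 := hD.x_start (le_refl D.r)
    have h1 := hD.x_finish (le_refl D.r)
    have hpath : Path B (D.x B D.r).start ([D.x B D.r] ++ D.mu B ++ D.lamAll B)
        (D.x B D.r).finish := by
      rw [x_finish_self]
      exact (((x_finish_self ▸ Path.single subset_rfl : Path B (D.x B D.r).start [D.x B D.r]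
        (D.P 0)).append hmu hP.subset).append hlam hP.subset)
    simp only [List.cons_append, List.nil_append] at hpath ⊢
    refine hpath.isFullDecomposition rfl ?_ hD.cover h0.1 h0.2 h1.1 h1.2.1
      (hD.exists_mem_start (fun j hj => ?_) fun j h₁ h₂ => ?_)
    · intro t ht
      simp only [List.mem_cons, List.mem_append] at ht
      rcases ht with rfl | ht | ht
      exacts [hD.isMosaic_x le_rfl, hMmu t ht, hMlam t ht]
    · simp [y_mem_mu hj]
    · have := x_mem_lamAll (B := B) h₁ h₂
      exact ⟨by simp [this.1], fun t ht => by simp [this.2 t ht]⟩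
  · have h0 := hD.point i hi.le
    have h1 := hD.point_y_finish hi.le
    have hpath : Path B (D.P i) (D.ySeq B i D.s ++ D.lamAll B ++ D.ySeq B 0 i)
        (D.y B i).finish := by
      have hy := hD.path_ySeq hi.le le_rfl
      rw [y_finish_self] at hy
      exact (hy.append hlam hP.subset).append (hD.path_ySeq (Nat.zero_le i) hi.le) hP.subset
    rw [D.ySeq_eq_cons B hi.le] at hpath ⊢
    simp only [List.append_assoc, List.cons_append] at hpath ⊢
    refine hpath.isFullDecomposition rfl ?_ hD.cover h0.start h0.untlCovered h1.finish
      h1.snceCovered (hD.exists_mem_start (fun j hj => ?_) fun j h₁ h₂ => ?_)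
    · intro t ht
      simp only [List.mem_cons, List.mem_append] at ht
      rcases ht with rfl | ht | ht | ht
      exacts [hD.isMosaic_y hi.le, hD.isMosaic_of_mem_ySeq le_rfl t ht, hMlam t ht,
        hD.isMosaic_of_mem_ySeq hi.le t ht]
    · rcases le_or_gt j i with hji | hij
      · have : D.y B j ∈ D.ySeq B 0 i := (D.mem_ySeq B).2 ⟨j, Nat.zero_le _, hji, rfl⟩
        simp [this]
      · have : D.y B j ∈ D.ySeq B (i + 1) D.s := (D.mem_ySeq B).2 ⟨j, hij, hj, rfl⟩
        simp [this]
    · have := x_mem_lamAll (B := B) h₁ h₂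
      exact ⟨by simp [this.1], fun t ht => by simp [this.2 t ht]⟩
  · have h0 := hD.point D.s le_rfl
    have h1 := hD.point_y_finish (le_refl D.s)
    have hpath : Path B (D.P D.s) ([D.y B D.s] ++ D.lamAll B ++ D.mu B) (D.y B D.s).finish := by
      rw [y_finish_self]
      exact (((y_finish_self ▸ Path.single subset_rfl : Path B (D.y B D.s).start [D.y B D.s]
        (D.P 0)).append hlam hP.subset).append hmu hP.subset)
    simp only [List.cons_append, List.nil_append] at hpath ⊢
    refine hpath.isFullDecomposition rfl ?_ hD.cover h0.start h0.untlCovered h1.finish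
      h1.snceCovered (hD.exists_mem_start (fun j hj => ?_) fun j h₁ h₂ => ?_)
    · intro t ht
      simp only [List.mem_cons, List.mem_append] at ht
      rcases ht with rfl | ht | ht
      exacts [hD.isMosaic_y le_rfl, hMlam t ht, hMmu t ht]
    · simp [y_mem_mu hj]
    · have := x_mem_lamAll (B := B) h₁ h₂
      exact ⟨by simp [this.1], fun t ht => by simp [this.2 t ht]⟩

end IsShuffleFor

/-- Admissible parameters of a shuffle are obtained by collecting, for each of the finitely many
formulas that have to occur, a point or a block in which it occurs. -/
theorem exists_isShuffleFor {φ : Formula Atom} {B P : Set (Formula Atom)}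
    {Q : Triple Atom → Prop} (hB : IsCover φ B) (hP : IsShufflePoint φ B P)
    (hocc : ∀ β ∈ φ.closure, sim β ∉ B → (∃ X, IsShufflePoint φ B X ∧ β ∈ X) ∨
      ∃ l, IsShuffleBlock φ B l ∧ (∀ x ∈ l, Q x) ∧ ((∃ x ∈ l, β ∈ x.start) ∨ β ∈ seqStop l)) :
    ∃ D, IsShuffleFor φ B D ∧ ∀ i, 1 ≤ i → i ≤ D.r → ∀ x ∈ D.lam i, Q x := by
  have key : ∀ F : Set (Formula Atom), F.Finite → (∀ β ∈ F, β ∈ φ.closure ∧ sim β ∉ B) →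
      ∃ (Ps : List (Set (Formula Atom))) (ls : List (List (Triple Atom))),
        (∀ X ∈ Ps, IsShufflePoint φ B X) ∧
        (∀ l ∈ ls, IsShuffleBlock φ B l ∧ ∀ x ∈ l, Q x) ∧
        ∀ β ∈ F, (∃ X ∈ Ps, β ∈ X) ∨
          ∃ l ∈ ls, (∃ x ∈ l, β ∈ x.start) ∨ β ∈ seqStop l := by
    intro F hF
    induction F, hF using Set.Finite.induction_on with
    | empty => exact fun _ => ⟨[], [], by simp⟩
    | @insert β F _ _ ih =>
      intro h
      obtain ⟨Ps, ls, h₁, h₂, h₃⟩ := ih fun γ hγ => h γ (Or.inr hγ)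
      rcases hocc β (h β (Or.inl rfl)).1 (h β (Or.inl rfl)).2 with ⟨X, hX, hβX⟩ | ⟨l, hl, hQ, hβl⟩
      · refine ⟨X :: Ps, ls, by simpa using ⟨hX, h₁⟩, h₂, ?_⟩
        rintro γ (rfl | hγ)
        · exact Or.inl ⟨X, by simp, hβX⟩
        · refine (h₃ γ hγ).imp ?_ id
          rintro ⟨Y, hY, hγY⟩
          exact ⟨Y, by simp [hY], hγY⟩
      · refine ⟨Ps, l :: ls, h₁, ?_, ?_⟩
        · intro l' hl'
          rcases List.mem_cons.1 hl' with rfl | hl'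
          · exact ⟨hl, hQ⟩
          · exact h₂ l' hl'
        · rintro γ (rfl | hγ)
          · exact Or.inr ⟨l, by simp, hβl⟩
          · refine (h₃ γ hγ).imp id ?_
            rintro ⟨l', hl', hγl'⟩
            exact ⟨l', by simp [hl'], hγl'⟩
  obtain ⟨Ps, ls, h₁, h₂, h₃⟩ := key {β | β ∈ φ.closure ∧ sim β ∉ B}
    ((closure_finite φ).subset fun β hβ => hβ.1) fun β hβ => hβ
  have hls : ∀ i, 1 ≤ i → i ≤ ls.length → ls.getD (i - 1) [] ∈ ls := by
    intro i hi₁ hi₂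
    rw [List.getD_eq_getElem _ _ (by lia)]
    exact List.getElem_mem _
  refine ⟨⟨Ps.length, ls.length, fun i => (P :: Ps).getD i ∅, fun i => ls.getD (i - 1) []⟩,
    ⟨hB, fun i hi => ?_, fun i hi₁ hi₂ => (h₂ _ (hls i hi₁ hi₂)).1, fun β hβ hs => ?_⟩,
    fun i hi₁ hi₂ => (h₂ _ (hls i hi₁ hi₂)).2⟩
  · have hi' : i < (P :: Ps).length := Nat.lt_succ_of_le hi
    have hmem := List.getElem_mem hi'
    change IsShufflePoint φ B ((P :: Ps).getD i ∅)
    rw [List.getD_eq_getElem _ _ hi']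
    rcases List.mem_cons.1 hmem with h | h
    · rwa [h]
    · exact h₁ _ h
  · rcases h₃ β ⟨hβ, hs⟩ with ⟨X, hX, hβX⟩ | ⟨l, hl, hβl⟩
    · obtain ⟨i, hi, rfl⟩ := List.getElem_of_mem hX
      refine Or.inl ⟨i + 1, hi, ?_⟩
      change β ∈ (P :: Ps).getD (i + 1) ∅
      rwa [List.getD_cons_succ, List.getD_eq_getElem _ _ hi]
    · obtain ⟨i, hi, rfl⟩ := List.getElem_of_mem hl
      refine Or.inr ⟨i + 1, by lia, hi, ?_⟩
      change (∃ x ∈ ls.getD (i + 1 - 1) [], β ∈ x.start) ∨ β ∈ seqStop (ls.getD (i + 1 - 1) [])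
      rwa [Nat.add_sub_cancel, List.getD_eq_getElem _ _ hi]

/-! ### Critical points -/

/-- Every non-empty set with an upper bound has a least upper bound. -/
class HasLUBs (T : Type*) [LinearOrder T] : Prop where
  exists_isLUB : ∀ S : Set T, S.Nonempty → BddAbove S → ∃ e, IsLUB S e

theorem HasLUBs.exists_isGLB {T : Type*} [LinearOrder T] [HasLUBs T] (S : Set T)
    (hS : S.Nonempty) (hb : BddBelow S) : ∃ e, IsGLB S e := by
  obtain ⟨e, he⟩ := HasLUBs.exists_isLUB (lowerBounds S) hb hS.bddAbove_lowerBounds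
  exact ⟨e, isLUB_lowerBounds.1 he⟩

section

variable {T : Type*} [LinearOrder T] {h : Atom → Set T} {φ : Formula Atom}
  {Q : Triple Atom → Prop}

/-- The end of the longest interval to the right of `u` below which all mosaics satisfy `Q`. -/
theorem exists_sup_allMos [HasLUBs T] {u y : T} (huy : u ≤ y) :
    ∃ e, u ≤ e ∧ e ≤ y ∧ (∀ v, u ≤ v → v < e → AllMos h φ Q u v) ∧
      ∀ v, e < v → v ≤ y → ¬ AllMos h φ Q u v := by
  have hu : u ∈ {v | u ≤ v ∧ v ≤ y ∧ AllMos h φ Q u v} := ⟨le_rfl, huy, allMos_self u⟩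
  obtain ⟨e, he⟩ := HasLUBs.exists_isLUB {v | u ≤ v ∧ v ≤ y ∧ AllMos h φ Q u v} ⟨u, hu⟩
    ⟨y, fun v hv => hv.2.1⟩
  have hue := he.1 hu
  refine ⟨e, hue, he.2 fun v hv => hv.2.1, fun v huv hve => ?_, fun v hev hvy hv =>
    (he.1 ⟨hue.trans hev.le, hvy, hv⟩).not_gt hev⟩
  obtain ⟨w, hw, hvw, -⟩ := he.exists_between hve
  exact hw.2.2.anti le_rfl hvw.le

theorem exists_inf_allMos [HasLUBs T] {x v : T} (hxv : x ≤ v) :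
    ∃ e, x ≤ e ∧ e ≤ v ∧ (∀ u, e < u → u ≤ v → AllMos h φ Q u v) ∧
      ∀ u, x ≤ u → u < e → ¬ AllMos h φ Q u v := by
  have hv : v ∈ {u | x ≤ u ∧ u ≤ v ∧ AllMos h φ Q u v} := ⟨hxv, le_rfl, allMos_self v⟩
  obtain ⟨e, he⟩ := HasLUBs.exists_isGLB {u | x ≤ u ∧ u ≤ v ∧ AllMos h φ Q u v} ⟨v, hv⟩
    ⟨x, fun u hu => hu.1⟩
  have hev := he.1 hv
  refine ⟨e, he.2 fun u hu => hu.1, hev, fun u heu huv => ?_, fun u hxu hue hu =>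
    (he.1 ⟨hxu, hue.le.trans hev, hu⟩).not_gt hue⟩
  obtain ⟨w, hw, -, hwu⟩ := he.exists_between heu
  exact hw.2.2.anti hwu.le le_rfl

/-- `d` is not the right end of a non-trivial subinterval of `[x, d]` all of whose mosaics
satisfy `Q`. -/
def LeftCritical (h : Atom → Set T) (φ : Formula Atom) (Q : Triple Atom → Prop) (x d : T) : Prop :=
  x < d ∧ ∀ u, x ≤ u → u < d → ¬ AllMos h φ Q u d

/-- Mirror image of `LeftCritical`. -/
def RightCritical (h : Atom → Set T) (φ : Formula Atom) (Q : Triple Atom → Prop) (c y : T) :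
    Prop :=
  c < y ∧ ∀ v, c < v → v ≤ y → ¬ AllMos h φ Q c v

/-- A left limit which is not reached with mosaics composed by leads and trails is critical. -/
theorem leftCritical_of_limit [DenselyOrdered T] {x u d : T} (hxu : x ≤ u)
    (hlim : ∀ v, u ≤ v → v < d → AllMos h φ (LeadTrailComposed φ Q) u v)
    (hd : ¬ AllMos h φ (LeadTrailComposed φ Q) u d) (hud : u < d) :
    LeftCritical h φ Q x d := by
  refine ⟨hxu.trans_lt hud, fun w hxw hwd hw => hd ?_⟩
  refine (hlim (max u w) (le_max_left _ _) (max_lt hud hwd)).trans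
    (isCompositional_leadTrailComposed φ Q) ?_
  exact (hw.anti (le_max_right _ _) le_rfl).mono fun a b hab => .of_mem (isMosaic_mos hab)

theorem rightCritical_of_limit [DenselyOrdered T] {d u y : T} (huy : u ≤ y)
    (hlim : ∀ v, d < v → v ≤ u → AllMos h φ (LeadTrailComposed φ Q) v u)
    (hd : ¬ AllMos h φ (LeadTrailComposed φ Q) d u) (hdu : d < u) :
    RightCritical h φ Q d y := by
  refine ⟨hdu.trans_le huy, fun w hdw hwy hw => hd ?_⟩
  refine AllMos.trans (isCompositional_leadTrailComposed φ Q) ?_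
    (hlim (min u w) (lt_min hdu hdw) (min_le_left _ _))
  exact (hw.anti le_rfl (min_le_right _ _)).mono fun a b hab => .of_mem (isMosaic_mos hab)

theorem rightCritical_of_sup [DenselyOrdered T] {u e d y : T} (hed : e < d)
    (hdy : d ≤ y) (hue : AllMos h φ (LeadTrailComposed φ Q) u e)
    (hmax : ∀ v, e < v → v ≤ d → ¬ AllMos h φ (LeadTrailComposed φ Q) u v) :
    RightCritical h φ Q e y := by
  refine ⟨hed.trans_le hdy, fun v hev hvy hv => ?_⟩
  refine hmax (min v d) (lt_min hev hed) (min_le_right _ _)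
    (hue.trans (isCompositional_leadTrailComposed φ Q) ?_)
  exact (hv.anti le_rfl (min_le_left _ _)).mono fun a b hab => .of_mem (isMosaic_mos hab)

theorem leftCritical_of_inf [DenselyOrdered T] {x c e v : T} (hce : c < e)
    (hxc : x ≤ c) (hev : AllMos h φ (LeadTrailComposed φ Q) e v)
    (hmin : ∀ u, c ≤ u → u < e → ¬ AllMos h φ (LeadTrailComposed φ Q) u v) :
    LeftCritical h φ Q x e := by
  refine ⟨hxc.trans_lt hce, fun u hxu hue hu => ?_⟩
  refine hmin (max u c) (le_max_right _ _) (max_lt hue hce)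
    (AllMos.trans (isCompositional_leadTrailComposed φ Q) ?_ hev)
  exact (hu.anti (le_max_left _ _) le_rfl).mono fun a b hab => .of_mem (isMosaic_mos hab)

/-- `B` is the cover of the mosaic between `x` and `y`, and the mosaics between points of `[x, y]`
with a larger cover satisfy `Q`. -/
structure IsMinimalCover (h : Atom → Set T) (φ : Formula Atom) (Q : Triple Atom → Prop)
    (B : Set (Formula Atom)) (x y : T) : Prop where
  lt : x < y
  cover_eq : intervalTruth h φ x y = B
  of_ne : ∀ a b, x ≤ a → a < b → b ≤ y → intervalTruth h φ a b ≠ B → Q (mos h φ a b)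

namespace IsMinimalCover

variable {B : Set (Formula Atom)} {x y : T}

theorem subset (H : IsMinimalCover h φ Q B x y) {a b : T} (hxa : x ≤ a) (hby : b ≤ y) :
    B ⊆ intervalTruth h φ a b :=
  H.cover_eq ▸ intervalTruth_anti hxa hby

theorem isCover (H : IsMinimalCover h φ Q B x y) : IsCover φ B :=
  H.cover_eq ▸ isCover_intervalTruth x y

theorem allMos_of_ne (H : IsMinimalCover h φ Q B x y) {u v : T} (hxu : x ≤ u) (hvy : v ≤ y)
    (hne : intervalTruth h φ u v ≠ B) : AllMos h φ Q u v := by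
  intro a b hua hab hbv
  refine H.of_ne a b (hxu.trans hua) hab (hbv.trans hvy) fun he => hne ?_
  exact Set.Subset.antisymm (he ▸ intervalTruth_anti hua hbv) (H.subset hxu hvy)

theorem intervalTruth_left (H : IsMinimalCover h φ Q B x y) {d : T}
    (hd : LeftCritical h φ Q x d) (hdy : d ≤ y) :
    ∀ u, x ≤ u → u < d → intervalTruth h φ u d = B :=
  fun u hxu hud => by_contra fun hne => hd.2 u hxu hud (H.allMos_of_ne hxu hdy hne)

theorem intervalTruth_right (H : IsMinimalCover h φ Q B x y) {c : T}
    (hc : RightCritical h φ Q c y) (hxc : x ≤ c) :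
    ∀ v, c < v → v ≤ y → intervalTruth h φ c v = B :=
  fun v hcv hvy => by_contra fun hne => hc.2 v hcv hvy (H.allMos_of_ne hxc hvy hne)

variable [DenselyOrdered T]

theorem isFinish (H : IsMinimalCover h φ Q B x y) {d : T} (hd : LeftCritical h φ Q x d)
    (hdy : d ≤ y) : IsFinish φ B (truth h φ d) ∧ SnceCovered B (truth h φ d) :=
  ⟨H.intervalTruth_left hd hdy x le_rfl hd.1 ▸ isFinish_truth hd.1,
    snceCovered_truth hd.1 (H.intervalTruth_left hd hdy)⟩

theorem isStart (H : IsMinimalCover h φ Q B x y) {c : T} (hc : RightCritical h φ Q c y)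
    (hxc : x ≤ c) : IsStart φ B (truth h φ c) ∧ UntlCovered B (truth h φ c) :=
  ⟨H.intervalTruth_right hc hxc y hc.1 le_rfl ▸ isStart_truth hc.1,
    untlCovered_truth hc.1 (H.intervalTruth_right hc hxc)⟩

theorem isShufflePoint (H : IsMinimalCover h φ Q B x y) {p : T} (hl : LeftCritical h φ Q x p)
    (hr : RightCritical h φ Q p y) : IsShufflePoint φ B (truth h φ p) where
  start := (H.isStart hr hl.1.le).1
  untlCovered := (H.isStart hr hl.1.le).2
  finish := (H.isFinish hl hr.1.le).1
  snceCovered := (H.isFinish hl hr.1.le).2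
  subset := H.cover_eq ▸ intervalTruth_subset_truth hl.1 hr.1

theorem isShuffleBlock (H : IsMinimalCover h φ Q B x y) {a b : T} (hab : a < b)
    (hl : LeftCritical h φ Q x a) (hr : RightCritical h φ Q b y) {l : List (Triple Atom)}
    (hc : ComposesTo l (mos h φ a b)) (hmos : ∀ t ∈ l, IsMosaic φ t) : IsShuffleBlock φ B l := by
  have hsub : B ⊆ intervalTruth h φ x y := H.cover_eq.ge
  have ha := H.isFinish hl (hab.trans hr.1).le
  have hb := H.isStart hr (hl.1.trans hab).le
  have h₁ : seqStart l = truth h φ a := hc.start_eq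
  have h₂ : seqStop l = truth h φ b := hc.finish_eq
  refine ⟨hc.ne_nil, hmos, ?_, h₂ ▸ hb.1, h₂ ▸ hb.2, h₁ ▸ ha.1, h₁ ▸ ha.2,
    h₁ ▸ hsub.trans (intervalTruth_subset_truth hl.1 (hab.trans hr.1)),
    h₂ ▸ hsub.trans (intervalTruth_subset_truth (hl.1.trans hab) hr.1)⟩
  rw [h₁, h₂]
  exact hc.path (H.subset hl.1.le hr.1.le)

/-! ### Intervals that contain a loop -/

variable [HasLUBs T]

/-- In the presence of a loop, every left critical point is reached from every smaller point. -/
theorem mos_to_leftCritical (H : IsMinimalCover h φ Q B x y)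
    (hloop : ∃ A σ, IsLoop φ (LeadTrailComposed φ Q) B A σ) {u d : T} (hxu : x ≤ u) (hud : u < d)
    (hdy : d ≤ y) (hd : LeftCritical h φ Q x d) :
    LeadTrailComposed φ (LeadTrailComposed φ Q) (mos h φ u d) := by
  have hcomp := isCompositional_leadTrailComposed φ (LeadTrailComposed φ Q)
  have hfin := H.isFinish hd hdy
  obtain ⟨e, hue, hed, hlim, hmax⟩ :=
    exists_sup_allMos (h := h) (φ := φ) (Q := LeadTrailComposed φ Q) hud.le
  by_cases he : AllMos h φ (LeadTrailComposed φ Q) u e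
  · rcases hed.eq_or_lt with rfl | hed
    · exact .of_mem (isMosaic_mos hud) (he u e le_rfl hud le_rfl)
    · have hcrit := rightCritical_of_sup hed hdy he hmax
      have hst := H.isStart hcrit (hxu.trans hue)
      obtain ⟨A, σ, hσ⟩ := hloop
      have hmos := hσ.lead_trail hst.1 hst.2 hfin.1 hfin.2
      rw [← H.intervalTruth_left hd hdy e (hxu.trans hue) hed, ← mos_eq] at hmos
      rcases hue.eq_or_lt with rfl | hue
      · exact hmos
      · exact hcomp.mos hue hed (.of_mem (isMosaic_mos hue) (he u e le_rfl hue le_rfl)) hmos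
  · -- The intervals to the right of `u` converge to `e` without reaching it, so that there is a
    -- loop before `e`, from which a trail leads to `d`.
    have hue' : u < e := hue.lt_of_ne fun hu => he (hu ▸ allMos_self u)
    have hcrit := leftCritical_of_limit hxu hlim he hue'
    obtain ⟨a, σ, hua, hae, hσ⟩ := exists_isLoop_left hue'
      (fun v hv => H.intervalTruth_left hcrit (hed.trans hdy) v (hxu.trans hv)) hlim
    have had := hae.trans_le hed
    have hmos := hσ.trail hfin.1 hfin.2
    rw [← H.intervalTruth_left hd hdy a (hxu.trans hua.le) had, ← mos_eq] at hmos
    exact hcomp.mos hua had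
      (.of_mem (isMosaic_mos hua) (hlim a hua.le hae u a le_rfl hua le_rfl)) hmos

/-- Mirror image of `mos_to_leftCritical`. -/
theorem mos_from_rightCritical (H : IsMinimalCover h φ Q B x y)
    (hloop : ∃ A σ, IsLoop φ (LeadTrailComposed φ Q) B A σ) {c v : T} (hxc : x ≤ c) (hcv : c < v)
    (hvy : v ≤ y) (hc : RightCritical h φ Q c y) :
    LeadTrailComposed φ (LeadTrailComposed φ Q) (mos h φ c v) := by
  have hcomp := isCompositional_leadTrailComposed φ (LeadTrailComposed φ Q)
  have hst := H.isStart hc hxc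
  obtain ⟨e, hce, hev, hlim, hmin⟩ :=
    exists_inf_allMos (h := h) (φ := φ) (Q := LeadTrailComposed φ Q) hcv.le
  by_cases he : AllMos h φ (LeadTrailComposed φ Q) e v
  · rcases hce.eq_or_lt with rfl | hce
    · exact .of_mem (isMosaic_mos hcv) (he c v le_rfl hcv le_rfl)
    · have hcrit := leftCritical_of_inf hce hxc he hmin
      have hfin := H.isFinish hcrit (hev.trans hvy)
      obtain ⟨A, σ, hσ⟩ := hloop
      have hmos := hσ.lead_trail hst.1 hst.2 hfin.1 hfin.2
      rw [← H.intervalTruth_right hc hxc e hce (hev.trans hvy), ← mos_eq] at hmos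
      rcases hev.eq_or_lt with rfl | hev
      · exact hmos
      · exact hcomp.mos hce hev hmos (.of_mem (isMosaic_mos hev) (he e v le_rfl hev le_rfl))
  · have hev' : e < v := hev.lt_of_ne fun hu => he (hu ▸ allMos_self e)
    have hcrit := rightCritical_of_limit hvy hlim he hev'
    obtain ⟨b, σ, heb, hbv, hσ⟩ := exists_isLoop_right hev'
      (fun w h₁ h₂ => H.intervalTruth_right hcrit (hxc.trans hce) w h₁ (h₂.trans hvy)) hlim
    have hcb := hce.trans_lt heb
    have hmos := hσ.lead hst.1 hst.2
    rw [← H.intervalTruth_right hc hxc b hcb (hbv.le.trans hvy), ← mos_eq] at hmos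
    exact hcomp.mos hcb hbv hmos
      (.of_mem (isMosaic_mos hbv) (hlim b heb hbv.le b v le_rfl hbv le_rfl))

/-- In the presence of a loop two rounds of leads and trails suffice: go to the last left critical
point, from there through an interval without critical points to a right critical one, and
on to the end. -/
theorem mos_of_isLoop (H : IsMinimalCover h φ Q B x y)
    (hloop : ∃ A σ, IsLoop φ (LeadTrailComposed φ Q) B A σ) :
    LeadTrailComposed φ (LeadTrailComposed φ Q) (mos h φ x y) := by
  have hcomp := isCompositional_leadTrailComposed φ (LeadTrailComposed φ Q)
  obtain ⟨d, hxd, hdy, hd, hlast⟩ : ∃ d, x ≤ d ∧ d ≤ y ∧ (x < d → LeftCritical h φ Q x d) ∧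
      ∀ e, d < e → e ≤ y → ¬ LeftCritical h φ Q x e := by
    by_cases hne : ∃ d, d ≤ y ∧ LeftCritical h φ Q x d
    · obtain ⟨d, hd⟩ := HasLUBs.exists_isLUB {d | d ≤ y ∧ LeftCritical h φ Q x d} hne
        ⟨y, fun d hd => hd.1⟩
      obtain ⟨d₀, hd₀⟩ := hne
      have hxd : x < d := hd₀.2.1.trans_le (hd.1 hd₀)
      refine ⟨d, hxd.le, hd.2 fun d hd => hd.1, fun _ => ⟨hxd, fun u hxu hud hu => ?_⟩,
        fun e hde hey he => (hd.1 ⟨hey, he⟩).not_gt hde⟩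
      obtain ⟨e, he, hue, hed⟩ := hd.exists_between hud
      exact he.2.2 u hxu hue (hu.anti le_rfl hed)
    · push Not at hne
      exact ⟨x, le_rfl, H.lt.le, fun hxx => absurd hxx (lt_irrefl x), fun e _ hey => hne e hey⟩
  have hsecond : d < y → LeadTrailComposed φ (LeadTrailComposed φ Q) (mos h φ d y) := by
    intro hdy
    obtain ⟨e, hde, hey, hlim, hmax⟩ :=
      exists_sup_allMos (h := h) (φ := φ) (Q := LeadTrailComposed φ Q) hdy.le
    have he : AllMos h φ (LeadTrailComposed φ Q) d e := by
      by_contra he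
      have hde' : d < e := hde.lt_of_ne fun hu => he (hu ▸ allMos_self d)
      exact hlast e hde' hey (leftCritical_of_limit hxd hlim he hde')
    rcases hey.eq_or_lt with rfl | hey
    · exact .of_mem (isMosaic_mos hdy) (he d e le_rfl hdy le_rfl)
    · have hcrit := rightCritical_of_sup hey le_rfl he hmax
      have hmos := H.mos_from_rightCritical hloop (hxd.trans hde) hey le_rfl hcrit
      rcases hde.eq_or_lt with rfl | hde
      · exact hmos
      · exact hcomp.mos hde hey (.of_mem (isMosaic_mos hde) (he d e le_rfl hde le_rfl)) hmos
  rcases hxd.eq_or_lt with rfl | hxd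
  · exact hsecond H.lt
  · have hfirst := H.mos_to_leftCritical hloop le_rfl hxd hdy (hd hxd)
    rcases hdy.eq_or_lt with rfl | hdy
    · exact hfirst
    · exact hcomp.mos hxd hdy hfirst (hsecond hdy)

end IsMinimalCover

end

/-! ### Intervals without loops -/

section

variable {T : Type*} [LinearOrder T]

/-- A transitive relation between points, inherited by subintervals, such that the intervals
related to a fixed end point by it are closed. -/
structure IsClosedRelation (G : T → T → Prop) (x y : T) : Prop where
  refl : ∀ u, G u u
  anti : ∀ u u' v v', G u v → u ≤ u' → v' ≤ v → G u' v'
  trans : ∀ u v w, G u v → G v w → G u w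
  left : ∀ u d, x ≤ u → u < d → d ≤ y → (∀ v, u ≤ v → v < d → G u v) → G u d
  right : ∀ d u, x ≤ d → d < u → u ≤ y → (∀ v, d < v → v ≤ u → G v u) → G d u

variable {G : T → T → Prop} {x y : T} [HasLUBs T]

/-- The points to the right of `u` and related to it form a closed interval. -/
theorem IsClosedRelation.exists_max (H : IsClosedRelation G x y) {u w : T} (hxu : x ≤ u)
    (huw : u ≤ w) (hwy : w ≤ y) : ∃ e, u ≤ e ∧ e ≤ w ∧ G u e ∧ ∀ v, e < v → v ≤ w → ¬ G u v := by
  have hu : u ∈ {v | u ≤ v ∧ v ≤ w ∧ G u v} := ⟨le_rfl, huw, H.refl u⟩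
  obtain ⟨e, he⟩ := HasLUBs.exists_isLUB {v | u ≤ v ∧ v ≤ w ∧ G u v} ⟨u, hu⟩
    ⟨w, fun v hv => hv.2.1⟩
  have hue := he.1 hu
  have hew : e ≤ w := he.2 fun v hv => hv.2.1
  refine ⟨e, hue, hew, ?_, fun v hev hvw hv => (he.1 ⟨hue.trans hev.le, hvw, hv⟩).not_gt hev⟩
  rcases hue.eq_or_lt with h | h
  · exact h ▸ H.refl u
  · refine H.left u e hxu h (hew.trans hwy) fun v huv hve => ?_
    obtain ⟨v', hv', hvv', -⟩ := he.exists_between hve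
    exact H.anti _ _ _ _ hv'.2.2 le_rfl hvv'.le

theorem IsClosedRelation.exists_min (H : IsClosedRelation G x y) {u w : T} (hxu : x ≤ u)
    (huw : u ≤ w) (hwy : w ≤ y) : ∃ e, u ≤ e ∧ e ≤ w ∧ G e w ∧ ∀ v, u ≤ v → v < e → ¬ G v w := by
  have hw : w ∈ {v | u ≤ v ∧ v ≤ w ∧ G v w} := ⟨huw, le_rfl, H.refl w⟩
  obtain ⟨e, he⟩ := HasLUBs.exists_isGLB {v | u ≤ v ∧ v ≤ w ∧ G v w} ⟨w, hw⟩
    ⟨u, fun v hv => hv.1⟩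
  have hew := he.1 hw
  have hue : u ≤ e := he.2 fun v hv => hv.1
  refine ⟨e, hue, hew, ?_, fun v huv hve hv => (he.1 ⟨huv, hve.le.trans hew, hv⟩).not_gt hve⟩
  rcases hew.eq_or_lt with h | h
  · exact h ▸ H.refl e
  · refine H.right e w (hxu.trans hue) h hwy fun v hev hvw => ?_
    obtain ⟨v', hv', -, hvv'⟩ := he.exists_between hev
    exact H.anti _ _ _ _ hv'.2.2 hvv'.le le_rfl

variable [DenselyOrdered T]

/-- An unrelated pair contains an unrelated pair in its interior, with end points that are also
unrelated to the old ones. -/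
theorem IsClosedRelation.exists_between (H : IsClosedRelation G x y) {a b : T} (hxa : x ≤ a)
    (hab : a < b) (hby : b ≤ y) (hG : ¬ G a b) :
    ∃ a' b', a < a' ∧ a' < b' ∧ b' < b ∧ ¬ G a a' ∧ ¬ G a' b' ∧ ¬ G b' b := by
  obtain ⟨e, hae, heb, he, hmax⟩ := H.exists_max hxa hab.le hby
  obtain ⟨f, haf, hfb, hf, hmin⟩ := H.exists_min hxa hab.le hby
  have hef : e < f := by
    by_contra! hfe
    exact hG (H.trans _ _ _ (H.anti _ _ _ _ he le_rfl hfe) hf)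
  by_contra! hcon
  have hin : ∀ a' b', e < a' → a' < b' → b' < f → G a' b' := by
    intro a' b' h₁ h₂ h₃
    by_contra hn
    exact hmin b' (hae.trans (h₁.trans h₂).le) h₃ (hcon a' b' (hae.trans_lt h₁) h₂ (h₃.trans_le hfb)
      (hmax a' h₁ ((h₂.trans h₃).le.trans hfb)) hn)
  obtain ⟨c, hec, hcf⟩ := _root_.exists_between hef
  have hcf' : G c f := by
    refine H.left c f (hxa.trans (hae.trans hec.le)) hcf (hfb.trans hby) fun v hcv hvf => ?_
    rcases hcv.eq_or_lt with rfl | hcv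
    · exact H.refl c
    · exact hin c v hec hcv hvf
  have hec' : G e c := by
    refine H.right e c (hxa.trans hae) hec ((hcf.le.trans hfb).trans hby) fun v hev hvc => ?_
    rcases hvc.eq_or_lt with rfl | hvc
    · exact H.refl v
    · exact hin v c hev hvc hcf
  exact hG (H.trans _ _ _ he (H.trans _ _ _ (H.trans _ _ _ hec' hcf') hf))

/-- In a separable order, unrelated points have between them a point not related to any other.
It is the intersection of nested intervals with unrelated end points, the `n`-th of which avoids
the `n`-th member of a countable dense set. -/
theorem IsClosedRelation.exists_isolated (H : IsClosedRelation G x y)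
    (hq : ∃ q : ℕ → T, ∀ a b, a < b → ∃ n, a < q n ∧ q n < b) (hxy : x < y) (hG : ¬ G x y) :
    ∃ p, x < p ∧ p < y ∧ (∀ u, u < p → ¬ G u p) ∧ ∀ v, p < v → ¬ G p v := by
  obtain ⟨q, hq⟩ := hq
  have step : ∀ (n : ℕ) (I : {I : T × T // x ≤ I.1 ∧ I.1 < I.2 ∧ I.2 ≤ y ∧ ¬ G I.1 I.2}),
      ∃ J : {I : T × T // x ≤ I.1 ∧ I.1 < I.2 ∧ I.2 ≤ y ∧ ¬ G I.1 I.2},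
        I.1.1 < J.1.1 ∧ J.1.2 < I.1.2 ∧ ¬ G I.1.1 J.1.1 ∧ ¬ G J.1.2 I.1.2 ∧
        ¬ (J.1.1 < q n ∧ q n < J.1.2) := by
    rintro n ⟨⟨a, b⟩, hxa, hab, hby, hab'⟩
    simp only at hxa hab hby hab'
    by_cases hqn : a < q n ∧ q n < b
    · by_cases hleft : G a (q n)
      · have hright : ¬ G (q n) b := fun hr => hab' (H.trans _ _ _ hleft hr)
        obtain ⟨a', b', h₁, h₂, h₃, h₄, h₅, h₆⟩ :=
          H.exists_between (hxa.trans hqn.1.le) hqn.2 hby hright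
        exact ⟨⟨⟨a', b'⟩, (hxa.trans hqn.1.le).trans h₁.le, h₂, h₃.le.trans hby, h₅⟩,
          hqn.1.trans h₁, h₃, fun hg => h₄ (H.anti _ _ _ _ hg hqn.1.le le_rfl), h₆,
          fun hc => hc.1.not_gt h₁⟩
      · obtain ⟨a', b', h₁, h₂, h₃, h₄, h₅, h₆⟩ :=
          H.exists_between hxa hqn.1 (hqn.2.le.trans hby) hleft
        exact ⟨⟨⟨a', b'⟩, hxa.trans h₁.le, h₂, (h₃.trans hqn.2).le.trans hby, h₅⟩,
          h₁, h₃.trans hqn.2, h₄, fun hg => h₆ (H.anti _ _ _ _ hg le_rfl hqn.2.le),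
          fun hc => hc.2.not_gt h₃⟩
    · obtain ⟨a', b', h₁, h₂, h₃, h₄, h₅, h₆⟩ := H.exists_between hxa hab hby hab'
      exact ⟨⟨⟨a', b'⟩, hxa.trans h₁.le, h₂, h₃.le.trans hby, h₅⟩, h₁, h₃, h₄, h₆,
        fun hc => hqn ⟨h₁.trans hc.1, hc.2.trans h₃⟩⟩
  choose f hf using step
  let I : ℕ → {I : T × T // x ≤ I.1 ∧ I.1 < I.2 ∧ I.2 ≤ y ∧ ¬ G I.1 I.2} :=
    fun n => Nat.rec ⟨⟨x, y⟩, le_rfl, hxy, le_rfl, hG⟩ f n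
  have hI : ∀ n, I (n + 1) = f n (I n) := fun n => rfl
  have hlt : ∀ n, (I n).1.1 < (I (n + 1)).1.1 := fun n => hI n ▸ (hf n (I n)).1
  have hgt : ∀ n, (I (n + 1)).1.2 < (I n).1.2 := fun n => hI n ▸ (hf n (I n)).2.1
  have hmono : StrictMono fun n => (I n).1.1 := strictMono_nat_of_lt_succ hlt
  have hanti : StrictAnti fun n => (I n).1.2 := strictAnti_nat_of_succ_lt hgt
  have hle : ∀ m n, (I m).1.1 ≤ (I n).1.2 := fun m n =>
    (hmono.monotone (le_max_left m n)).trans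
      ((I (max m n)).2.2.1.le.trans (hanti.antitone (le_max_right m n)))
  obtain ⟨p, hp⟩ := HasLUBs.exists_isLUB (Set.range fun n => (I n).1.1) (Set.range_nonempty _)
    ⟨y, by
      rintro _ ⟨n, rfl⟩
      exact hle n 0⟩
  have hap : ∀ n, (I n).1.1 < p := fun n => (hlt n).trans_le (hp.1 ⟨n + 1, rfl⟩)
  have hpb : ∀ n, p < (I n).1.2 := fun n => (hp.2 (by
    rintro _ ⟨m, rfl⟩
    exact hle m (n + 1))).trans_lt (hgt n)
  refine ⟨p, hap 0, hpb 0, fun u hup hg => ?_, fun v hpv hg => ?_⟩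
  · obtain ⟨_, ⟨n, rfl⟩, hun, -⟩ := hp.exists_between hup
    exact (hf n (I n)).2.2.1 (H.anti _ _ _ _ hg hun.le (hap (n + 1)).le)
  · obtain ⟨n, hn⟩ : ∃ n, (I n).1.2 < v := by
      by_contra! hcon
      obtain ⟨k, hk₁, hk₂⟩ := hq p v hpv
      exact (hf k (I k)).2.2.2.2 ⟨(hap (k + 1)).trans hk₁, hk₂.trans_le (hcon (k + 1))⟩
    exact (hf n (I n)).2.2.2.1 (H.anti _ _ _ _ hg (hpb (n + 1)).le hn.le)

end

section

variable {T : Type*} [LinearOrder T] [DenselyOrdered T] {h : Atom → Set T} {φ : Formula Atom}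
  {Q : Triple Atom → Prop} {B : Set (Formula Atom)} {x y : T}

/-- Between a right critical and a left critical point that are not joined by leads and trails, if
there are no loops then there is a shuffle. Its points and blocks are the maximal closed
intervals on which leads and trails suffice, chosen to the right of a point that is
critical from both sides. -/
theorem IsMinimalCover.shuffleComposed [HasLUBs T] (H : IsMinimalCover h φ Q B x y)
    (hq : ∃ q : ℕ → T, ∀ a b, a < b → ∃ n, a < q n ∧ q n < b)
    (hG : IsClosedRelation (AllMos h φ (LeadTrailComposed φ Q)) x y)
    (hxy : ¬ AllMos h φ (LeadTrailComposed φ Q) x y) :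
    ShuffleComposed φ (LeadTrailComposed φ Q) (mos h φ x y) := by
  have hQ : ∀ {a b : T}, AllMos h φ Q a b → AllMos h φ (LeadTrailComposed φ Q) a b :=
    fun hab => hab.mono fun a b hab => .of_mem (isMosaic_mos hab)
  have hcomp := isCompositional_shuffleComposed φ (LeadTrailComposed φ Q)
  obtain ⟨x', hxx', hx'y, hx', hmax⟩ := hG.exists_max le_rfl H.lt.le le_rfl
  obtain ⟨y', hxy', hy'y, hy', hmin⟩ := hG.exists_min le_rfl H.lt.le le_rfl
  have hlt : x' < y' := by
    by_contra! hle
    exact hxy (hG.trans _ _ _ (hG.anti _ _ _ _ hx' le_rfl hle) hy')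
  have hcx : RightCritical h φ Q x' y :=
    ⟨hlt.trans_le hy'y, fun v h₁ h₂ hv => hmax v h₁ h₂ (hG.trans _ _ _ hx' (hQ hv))⟩
  have hcy : LeftCritical h φ Q x y' :=
    ⟨hxx'.trans_lt hlt, fun u h₁ h₂ hu => hmin u h₁ h₂ (hG.trans _ _ _ (hQ hu) hy')⟩
  have hx'y' : ¬ AllMos h φ (LeadTrailComposed φ Q) x' y' :=
    fun hg => hmin x' hxx' hlt (hG.trans _ _ _ hg hy')
  have hG' : IsClosedRelation (AllMos h φ (LeadTrailComposed φ Q)) x' y' :=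
    ⟨hG.refl, hG.anti, hG.trans, fun u d h₁ h₂ h₃ => hG.left u d (hxx'.trans h₁) h₂
      (h₃.trans hy'y), fun d u h₁ h₂ h₃ => hG.right d u (hxx'.trans h₁) h₂ (h₃.trans hy'y)⟩
  obtain ⟨p, hxp, hpy, hpl, hpr⟩ := hG'.exists_isolated hq hlt hx'y'
  have hpl' : LeftCritical h φ Q x p :=
    ⟨hxx'.trans_lt hxp, fun u _ hup hu => hpl u hup (hQ hu)⟩
  have hpr' : RightCritical h φ Q p y :=
    ⟨hpy.trans_le hy'y, fun v hpv _ hv => hpr v hpv (hQ hv)⟩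
  have hocc : ∀ β ∈ φ.closure, sim β ∉ B → (∃ X, IsShufflePoint φ B X ∧ β ∈ X) ∨
      ∃ l, IsShuffleBlock φ B l ∧ (∀ t ∈ l, LeadTrailComposed φ Q t) ∧
        ((∃ t ∈ l, β ∈ t.start) ∨ β ∈ seqStop l) := by
    intro β hβ hs
    rw [← H.intervalTruth_left hcy hy'y p hpl'.1.le hpy] at hs
    obtain ⟨z, hpz, hzy', hβz⟩ := exists_sat_of_sim_notMem_intervalTruth hβ hs
    have hβz' : β ∈ truth h φ z := ⟨hβ, hβz⟩
    have hxz : x ≤ z := hpl'.1.le.trans hpz.le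
    have hzy : z ≤ y := hzy'.le.trans hy'y
    obtain ⟨a, hxa, haz, hGa, hmina⟩ := hG.exists_min le_rfl hxz hzy
    obtain ⟨b, hzb, hby, hGb, hmaxb⟩ := hG.exists_max hxz hzy le_rfl
    -- The criticality of `p` and `y'` keeps the maximal interval `[a, b]` around `z` strictly
    -- between them, so that its end points are critical.
    have hpa : p < a := by
      by_contra! hap
      exact hpr z hpz (hG.anti _ _ _ _ hGa hap le_rfl)
    have hby' : b < y' := by
      by_contra! hyb
      exact hmin z hxz hzy' (hG.trans _ _ _ (hG.anti _ _ _ _ hGb le_rfl hyb) hy')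
    have hca : LeftCritical h φ Q x a :=
      ⟨hpl'.1.trans hpa, fun u h₁ h₂ hu => hmina u h₁ h₂ (hG.trans _ _ _ (hQ hu) hGa)⟩
    have hcb : RightCritical h φ Q b y :=
      ⟨hby'.trans_le hy'y, fun v h₁ h₂ hv => hmaxb v h₁ h₂ (hG.trans _ _ _ hGb (hQ hv))⟩
    have hab := hG.trans _ _ _ hGa hGb
    rcases haz.eq_or_lt with rfl | haz
    · rcases hzb.eq_or_lt with rfl | hzb
      · exact Or.inl ⟨_, H.isShufflePoint hca hcb, hβz'⟩
      · exact Or.inr ⟨[mos h φ a b], H.isShuffleBlock hzb hca hcb (.single _)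
          (by simpa using isMosaic_mos hzb), by simpa using hab a b le_rfl hzb le_rfl,
          Or.inl ⟨_, List.mem_singleton_self _, hβz'⟩⟩
    · rcases hzb.eq_or_lt with rfl | hzb
      · exact Or.inr ⟨[mos h φ a z], H.isShuffleBlock haz hca hcb (.single _)
          (by simpa using isMosaic_mos haz), by simpa using hab a z le_rfl haz le_rfl,
          Or.inr hβz'⟩
      · refine Or.inr ⟨[mos h φ a z, mos h φ z b], H.isShuffleBlock (haz.trans hzb) hca hcb
          (composesTo_mos_pair haz hzb) ?_, ?_, Or.inl ⟨mos h φ z b, by simp, hβz'⟩⟩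
        · simpa using ⟨isMosaic_mos haz, isMosaic_mos hzb⟩
        · simpa using ⟨hab a z le_rfl haz hzb.le, hab z b haz.le hzb le_rfl⟩
  obtain ⟨D, hD, hDQ⟩ := exists_isShuffleFor H.isCover (H.isShufflePoint hpl' hpr') hocc
  have hst := H.isStart hcx hxx'
  have hfin := H.isFinish hcy hy'y
  have hmid : ShuffleComposed φ (LeadTrailComposed φ Q) (mos h φ x' y') := by
    refine ⟨_, isDecomposition_singleton (isMosaic_mos hlt), fun t ht => Or.inr ⟨D, ?_, hDQ⟩⟩
    rw [List.mem_singleton.1 ht, mos_eq, H.intervalTruth_right hcx hxx' y' hlt hy'y]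
    exact hD.fullyDecomposedByShuffle hst.1 hst.2 hfin.1 hfin.2
  have hleft : ShuffleComposed φ (LeadTrailComposed φ Q) (mos h φ x y') := by
    rcases hxx'.eq_or_lt with rfl | hxx'
    · exact hmid
    · exact hcomp.mos hxx' hlt (.of_mem (isMosaic_mos hxx') (hx' x x' le_rfl hxx' le_rfl)) hmid
  rcases hy'y.eq_or_lt with rfl | hy'y
  · exact hleft
  · exact hcomp.mos hcy.1 hy'y hleft (.of_mem (isMosaic_mos hy'y) (hy' y' y le_rfl hy'y le_rfl))

/-- One level suffices to reduce a mosaic of a structure to mosaics with larger covers. If some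
limit of intervals composed by leads and trails is not itself so composed, then there is a loop
near this limit; otherwise the relation required for a shuffle is closed. -/
theorem IsMinimalCover.mos_shuffleComposed [HasLUBs T] (H : IsMinimalCover h φ Q B x y)
    (hq : ∃ q : ℕ → T, ∀ a b, a < b → ∃ n, a < q n ∧ q n < b) :
    ShuffleComposed φ (LeadTrailComposed φ (LeadTrailComposed φ Q)) (mos h φ x y) := by
  have hcomp := isCompositional_leadTrailComposed φ Q
  have of_loop : (∃ A σ, IsLoop φ (LeadTrailComposed φ Q) B A σ) →
      ShuffleComposed φ (LeadTrailComposed φ (LeadTrailComposed φ Q)) (mos h φ x y) :=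
    fun hl => .of_mem (isMosaic_mos H.lt) (H.mos_of_isLoop hl)
  by_cases hleft : ∀ u d, x ≤ u → u < d → d ≤ y →
      (∀ v, u ≤ v → v < d → AllMos h φ (LeadTrailComposed φ Q) u v) →
      AllMos h φ (LeadTrailComposed φ Q) u d
  swap
  · push Not at hleft
    obtain ⟨u, d, hxu, hud, hdy, hlim, hd⟩ := hleft
    have hcrit := leftCritical_of_limit hxu hlim hd hud
    obtain ⟨a, σ, -, -, hσ⟩ := exists_isLoop_left hud
      (fun v hv => H.intervalTruth_left hcrit hdy v (hxu.trans hv)) hlim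
    exact of_loop ⟨_, σ, hσ⟩
  by_cases hright : ∀ d u, x ≤ d → d < u → u ≤ y →
      (∀ v, d < v → v ≤ u → AllMos h φ (LeadTrailComposed φ Q) v u) →
      AllMos h φ (LeadTrailComposed φ Q) d u
  swap
  · push Not at hright
    obtain ⟨d, u, hxd, hdu, huy, hlim, hd⟩ := hright
    have hcrit := rightCritical_of_limit huy hlim hd hdu
    obtain ⟨b, σ, -, -, hσ⟩ := exists_isLoop_right hdu
      (fun v h₁ h₂ => H.intervalTruth_right hcrit hxd v h₁ (h₂.trans huy)) hlim
    exact of_loop ⟨_, σ, hσ⟩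
  have hmono : ∀ m, LeadTrailComposed φ Q m →
      LeadTrailComposed φ (LeadTrailComposed φ Q) m := fun m hm => by
    obtain ⟨l, hl, -⟩ := id hm
    exact .of_mem hl.1 hm
  by_cases hxy : AllMos h φ (LeadTrailComposed φ Q) x y
  · exact .of_mem (isMosaic_mos H.lt) (hmono _ (hxy x y le_rfl H.lt le_rfl))
  · exact (H.shuffleComposed hq ⟨allMos_self, fun u u' v v' => AllMos.anti,
      fun u v w => AllMos.trans hcomp, hleft, hright⟩ hxy).mono hmono

/-- A mosaic of a structure has the number of formulas outside its cover as a level. -/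
theorem isLevel_mos [HasLUBs T] (hq : ∃ q : ℕ → T, ∀ a b, a < b → ∃ n, a < q n ∧ q n < b)
    (n : ℕ) : ∀ x y : T, x < y → (φ.closure \ intervalTruth h φ x y).ncard ≤ n →
      IsLevel φ Set.univ n (mos h φ x y) := by
  have hlt : ∀ {x y a b : T}, x ≤ a → b ≤ y → intervalTruth h φ a b ≠ intervalTruth h φ x y →
      (φ.closure \ intervalTruth h φ a b).ncard < (φ.closure \ intervalTruth h φ x y).ncard := by
    intro x y a b hxa hby hne
    have hsub : intervalTruth h φ x y ⊂ intervalTruth h φ a b :=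
      (intervalTruth_anti hxa hby).ssubset_of_ne hne.symm
    obtain ⟨β, hβ, hnβ⟩ := Set.exists_of_ssubset hsub
    exact Set.ncard_lt_ncard ⟨Set.sdiff_subset_sdiff_right hsub.subset,
      fun hle => (hle ⟨hβ.1, hnβ⟩).2 hβ⟩ (closure_finite φ).sdiff
  induction n with
  | zero =>
    intro x y hxy hn
    have H : IsMinimalCover h φ (fun _ => False) (intervalTruth h φ x y) x y :=
      ⟨hxy, rfl, fun a b hxa _ hby hne => absurd (hlt hxa hby hne) (by lia)⟩
    -- No mosaic has level `0⁻`, and leads and trails, being non-empty, add none.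
    have hfalse : ∀ {Q : Triple Atom → Prop}, (∀ m, ¬ Q m) → ∀ m, ¬ LeadTrailComposed φ Q m := by
      rintro Q hQ m ⟨l, hl, hx⟩
      obtain ⟨t, ht⟩ := List.exists_mem_of_ne_nil l hl.2.2.ne_nil
      rcases hx t ht with h | ⟨σ, hσ, ⟨hne, -⟩ | ⟨hne, -⟩⟩
      · exact hQ t h
      · obtain ⟨s, hs⟩ := List.exists_mem_of_ne_nil σ hne
        exact hQ s (hσ s hs)
      · obtain ⟨s, hs⟩ := List.exists_mem_of_ne_nil σ hne
        exact hQ s (hσ s hs)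
    exact ⟨trivial, (H.mos_shuffleComposed hq).mono (hfalse (hfalse fun _ => id))⟩
  | succ n ih =>
    intro x y hxy hn
    have H : IsMinimalCover h φ (IsLevel φ Set.univ n) (intervalTruth h φ x y) x y :=
      ⟨hxy, rfl, fun a b hxa hab hby hne =>
        ih a b hab (by have := hlt hxa hby hne; lia)⟩
    exact ⟨trivial, H.mos_shuffleComposed hq⟩

end

instance : HasLUBs (Set.Icc (0 : ℝ) 1) where
  exists_isLUB := by
    intro S hne _
    obtain ⟨s, hs⟩ := hne
    have hbdd : ∀ t ∈ Subtype.val '' S, t ≤ 1 := by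
      rintro _ ⟨t, -, rfl⟩
      exact t.2.2
    have hlub := isLUB_csSup (s := Subtype.val '' S) ⟨s.1, s, hs, rfl⟩ ⟨1, hbdd⟩
    refine ⟨⟨sSup (Subtype.val '' S), s.2.1.trans (hlub.1 ⟨s, hs, rfl⟩), hlub.2 hbdd⟩,
      fun t ht => hlub.1 ⟨t, ht, rfl⟩, fun u hu => hlub.2 ?_⟩
    rintro _ ⟨t, ht, rfl⟩
    exact hu ht

theorem exists_dense_seq_Icc : ∃ q : ℕ → Set.Icc (0 : ℝ) 1, ∀ a b, a < b →
    ∃ n, a < q n ∧ q n < b := by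
  obtain ⟨q, hq⟩ := TopologicalSpace.exists_dense_seq (Set.Icc (0 : ℝ) 1)
  refine ⟨q, fun a b hab => ?_⟩
  obtain ⟨_, ⟨n, rfl⟩, h₁, h₂⟩ := hq.exists_between hab
  exact ⟨n, h₁, h₂⟩

end RTL

theorem mainTheorem3 {Atom : Type*} [Countable Atom] (ψ : RTL.Formula Atom) (L : ℕ)
    (hL : ψ.length = L) (m₀ : RTL.Triple Atom) (hm₀ : RTL.IsMosaic ψ m₀)
    (hsat : RTL.IsSatisfiableOn (Set.Icc (0 : ℝ) 1) ψ m₀) :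
    ∃ S : Set (RTL.Triple Atom), RTL.IsRealMosaicSystemOfDepth ψ S (2 * L) ∧ m₀ ∈ S := by
  obtain ⟨h, x, y, hxy, rfl⟩ := hsat
  refine ⟨_, RTL.isRealMosaicSystemOfDepth_isLevel_univ ψ (2 * L),
    RTL.isLevel_mos RTL.exists_dense_seq_Icc _ x y hxy ?_⟩
  exact (Set.ncard_le_ncard Set.sdiff_subset (RTL.closure_finite ψ)).trans
    (hL ▸ RTL.closure_ncard_le ψ)
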